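/- Let $X$ be a (real or complex) Fréchet space, i.e. a complete Hausdorff locally convex space whose topology is generated by a sequence of seminorms $p_n$, $n\in\mathbb N$. A signed (finite) Borel measure $\mu$ on a Hausdorff space is called Radon if for every Borel set $B$ and every $\varepsilon>0$ there is a compact set $K\subset B$ with $|\mu|(B\setminus K)<\varepsilon$, where $|\mu|=\mu^++\mu^-$ is the total variation. Let $\mathcal M$ be a uniformly tight family of signed Radon measures on $X$, i.e. for every $\varepsilon>0$ there is a compact set $K\subset X$ such that $|\mu|(X\setminus K)<\varepsilon$ for all $\mu\in\mathcal M$. Suppose that every $p_n$ is uniformly integrable with respect to $\mathcal M$, i.e. $$\lim_{m\to\infty}\ \sup_{\mu\in\mathcal M}\int_{\{x:\,p_n(x)>m\}}p_n(x)\,|\mu|(dx)=0\qquad\text{for every } n.$$ Then there is a linear subspace $E\subset X$ with a norm $\|\cdot\|_E$ such that: (i) $(E,\|\cdot\|_E)$ is a separable reflexive Banach space whose closed unit ball is compact in $X$; (ii) the Borel $\sigma$-algebra of $(E,\|\cdot\|_E)$ consists exactly of the sets $B\cap E$ with $B$ Borel in $X$, and $E$ and all Borel sets of $(E,\|\cdot\|_E)$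 are Borel in $X$; every $\mu\in\mathcal M$ is concentrated on $E$, i.e. $|\mu|(X\setminus E)=0$; the restrictions of the measures $\mu\in\mathcal M$ to the Borel $\sigma$-algebra of $(E,\|\cdot\|_E)$ are Radon measures on $(E,\|\cdot\|_E)$ and form a uniformly tight family there (with compact sets of $(E,\|\cdot\|_E)$); and the norm is uniformly integrable: $$\lim_{m\to\infty}\ \sup_{\mu\in\mathcal M}\int_{\{x\in E:\,\|x\|_E>m\}}\|x\|_E\,|\mu|(dx)=0 .$$ -/

import Mathlib

open MeasureTheory Filter Topology

noncomputable section

/-! ### Families of Radon measures -/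

section Measures

variable {X : Type*} [MeasurableSpace X]

/-- A signed Borel measure `μ` is Radon if for every Borel set `B` and every `ε > 0` there is a
compact set `K ⊆ B` with `|μ|(B \ K) < ε`. -/
def IsRadonSigned [TopologicalSpace X] (μ : SignedMeasure X) : Prop :=
  ∀ B : Set X, MeasurableSet B → ∀ ε : ENNReal, 0 < ε →
    ∃ K : Set X, IsCompact K ∧ K ⊆ B ∧ μ.totalVariation (B \ K) < ε

/-- A set `M` of signed measures is uniformly tight if for every `ε > 0` there is a compact set `K`
with `|μ|(X \ K) < ε` for all `μ ∈ M`. -/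
def UniformlyTight [TopologicalSpace X] (M : Set (SignedMeasure X)) : Prop :=
  ∀ ε : ENNReal, 0 < ε → ∃ K : Set X, IsCompact K ∧ ∀ μ ∈ M, μ.totalVariation Kᶜ < ε

/-- A (nonnegative measurable) function `p` is uniformly integrable with respect to the measures
in `M`: the integrals of `p` over `{p > m}` against `|μ|` tend to zero as `m → ∞`, uniformly in
`μ ∈ M`. -/
def UniformlyIntegrableOver (M : Set (SignedMeasure X)) (p : X → ℝ) : Prop :=
  Tendsto (fun m : ℝ => ⨆ μ ∈ M, ∫⁻ x in {x | m < p x}, ENNReal.ofReal (p x) ∂μ.totalVariation)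
    atTop (𝓝 0)

/-- For a measurable embedding `f : Y → X`, the signed measure `B ↦ μ (f '' B)` on `Y`; if `f` is
the inclusion of a subspace, this is the restriction of `μ` to the subspace. -/
def restrictAlong {Y : Type*} [MeasurableSpace Y] {f : Y → X} (hf : MeasurableEmbedding f)
    (μ : SignedMeasure X) : SignedMeasure Y where
  measureOf' B := μ (f '' B)
  empty' := by simp
  not_measurable' B hB := μ.not_measurable fun h => hB (hf.measurableSet_image.1 h)
  m_iUnion' B hB hd := by
    rw [Set.image_iUnion]
    exact μ.m_iUnion (fun i => hf.measurableSet_image.2 (hB i)) fun i j hij =>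
      (Set.disjoint_image_iff hf.injective).2 (hd hij)

end Measures

/-! ### Linear subspaces with a norm of their own -/

/-- A linear subspace of `X` together with a norm on it, which need not be related to the topology
of `X`. -/
structure NormedSubspace (𝕜 : Type*) [RCLike 𝕜] (X : Type*) [AddCommGroup X] [Module 𝕜 X] where
  /-- the linear subspace -/
  carrier : Submodule 𝕜 X
  /-- the norm on it -/
  norm : Seminorm 𝕜 carrier
  eq_zero_of_norm : ∀ x, norm x = 0 → x = 0

namespace NormedSubspace

variable {𝕜 : Type*} [RCLike 𝕜] {X : Type*} [AddCommGroup X] [Module 𝕜 X]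

/-- The subspace as a type of its own, carrying its own norm, the norm topology and the Borel
σ-algebra of the norm topology (not the structures induced by `X`). -/
def Space (E : NormedSubspace 𝕜 X) : Type _ := E.carrier

variable (E : NormedSubspace 𝕜 X)

instance : AddCommGroup E.Space := inferInstanceAs (AddCommGroup E.carrier)

instance : Module 𝕜 E.Space := inferInstanceAs (Module 𝕜 E.carrier)

instance : NormedAddCommGroup E.Space :=
  AddGroupNorm.toNormedAddCommGroup (E := E.Space)
    { toFun := fun x => E.norm x
      map_zero' := map_zero E.norm
      add_le' := map_add_le_add E.norm
      neg' := map_neg_eq_map E.norm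
      eq_zero_of_map_eq_zero' := E.eq_zero_of_norm }

instance : NormedSpace 𝕜 E.Space where
  norm_smul_le c x := (map_smul_eq_mul E.norm c x).le

instance : MeasurableSpace E.Space := borel E.Space

instance : BorelSpace E.Space := ⟨rfl⟩

/-- The inclusion of the subspace into `X`. -/
def incl : E.Space →ₗ[𝕜] X := E.carrier.subtype

end NormedSubspace

/-- A normed space is reflexive if the canonical map into its bidual is onto. -/
def IsReflexiveSpace (𝕜 : Type*) [RCLike 𝕜] (F : Type*) [NormedAddCommGroup F]
    [NormedSpace 𝕜 F] : Prop :=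
  Function.Surjective (NormedSpace.inclusionInDoubleDual 𝕜 F)

end

/-! Put `w j = 1 + p 0 + ⋯ + p j`. Tightness and uniform integrability give increasing compact sets
`K j` such that the integral of `w j` outside `K j` is at most `4 ^ (-j)` for every `|μ|`
(`UniformlyTight.smallOutsideCompacts`, `exists_monotone_compacts_setLIntegral_le`). Dividing each
`x ∈ K (j + 1)` by `2 ^ j * w j x` yields compact sets that shrink to `0`, so their union is totally
bounded. Suppose this union lies in a compact set `Q` of a suitable Banach space `E`. Then `‖x‖_E ≤
R * 2 ^ j * w j x` on `K (j + 1)`, the shell `K (j + 1) \ K j` contributes at most `R * 2 ^ (-j)` to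
the integral of the norm, and the shells beyond `K N` together at most `2 * R * 2 ^ (-N)`. The `K j`
are also compact in `E`, which gives tightness there and confines `{‖x‖_E > m}` to the complement of
`K N` for large `m`.

The space `E` comes from `WithSeminorms.exists_reflexive_normedSubspace`. Telescoping finite nets
writes each point of a totally bounded set as a series whose terms lie in finite sets `F k` of
rapidly decreasing size. Let `τ k` map `ℓ¹(F k)` to `X` by sending basis vectors to `2 ^ k • f`, and
let `E` be the image of the `ℓ²`-sum of these finite-dimensional spaces, with the quotient norm. Its
unit ball is the set of sums over the `ℓ²`-ball, a compact set for the product topology. Summation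
is continuous on it into `X` and weakly continuous into `E`; this gives compactness in `X` and
reflexivity. The given points have coordinates of norm `2 ^ (-k)`, for which the series converge
uniformly in the norm of `E`, hence compactness in `E`. Finally `E` is Polish, so its inclusion is a
Borel embedding and finite measures on it are Radon. -/

/-! ### The Banach space spanned by a compact disk -/

/-- `B` is stable under all combinations `a • x + b • y` with `‖a‖ + ‖b‖ ≤ 1`, and contains `0`. -/
structure IsDisk (𝕜 : Type*) [RCLike 𝕜] {X : Type*} [AddCommGroup X] [Module 𝕜 X]
    (B : Set X) : Prop where
  zero_mem : (0 : X) ∈ B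
  combo_mem : ∀ x ∈ B, ∀ y ∈ B, ∀ a b : 𝕜, ‖a‖ + ‖b‖ ≤ 1 → a • x + b • y ∈ B

/-- The real numbers `r ≥ 0` with `x ∈ r • B`. -/
def dilationSet (𝕜 : Type*) [RCLike 𝕜] {X : Type*} [AddCommGroup X] [Module 𝕜 X]
    (B : Set X) (x : X) : Set ℝ :=
  {r | 0 ≤ r ∧ ∃ b ∈ B, x = (r : 𝕜) • b}

section Disk

variable {𝕜 : Type*} [RCLike 𝕜] {X : Type*} [AddCommGroup X] [Module 𝕜 X] {B : Set X}

theorem IsDisk.smul_mem (hB : IsDisk 𝕜 B) {x : X} (hx : x ∈ B) {a : 𝕜} (ha : ‖a‖ ≤ 1) :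
    a • x ∈ B := by
  simpa using hB.combo_mem x hx x hx a 0 (by simpa using ha)

theorem IsDisk.dilationSet_mono (hB : IsDisk 𝕜 B) {x : X} {r s : ℝ}
    (hr : r ∈ dilationSet 𝕜 B x) (hrs : r ≤ s) : s ∈ dilationSet 𝕜 B x := by
  obtain ⟨h0, b, hb, rfl⟩ := hr
  refine ⟨h0.trans hrs, ?_⟩
  rcases (h0.trans hrs).eq_or_lt with hs | hs
  · obtain rfl : r = 0 := le_antisymm (hs ▸ hrs) h0
    exact ⟨b, hb, by rw [← hs]⟩
  · refine ⟨((r / s : ℝ) : 𝕜) • b, hB.smul_mem hb ?_, ?_⟩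
    · rw [RCLike.norm_ofReal, abs_of_nonneg (by positivity)]
      exact div_le_one_of_le₀ hrs hs.le
    · rw [smul_smul, ← RCLike.ofReal_mul, mul_div_cancel₀ _ hs.ne']

theorem IsDisk.dilationSet_add (hB : IsDisk 𝕜 B) {x y : X} {r s : ℝ}
    (hr : r ∈ dilationSet 𝕜 B x) (hs : s ∈ dilationSet 𝕜 B y) :
    r + s ∈ dilationSet 𝕜 B (x + y) := by
  obtain ⟨h0, b, hb, rfl⟩ := hr
  obtain ⟨h1, c, hc, rfl⟩ := hs
  refine ⟨add_nonneg h0 h1, ?_⟩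
  rcases (add_nonneg h0 h1).eq_or_lt with h | h
  · obtain rfl : r = 0 := by linarith
    obtain rfl : s = 0 := by linarith
    exact ⟨b, hb, by simp⟩
  · refine ⟨((r / (r + s) : ℝ) : 𝕜) • b + ((s / (r + s) : ℝ) : 𝕜) • c,
      hB.combo_mem _ hb _ hc _ _ ?_, ?_⟩
    · rw [RCLike.norm_ofReal, RCLike.norm_ofReal, abs_of_nonneg (by positivity),
        abs_of_nonneg (by positivity), ← add_div, div_self h.ne']
    · rw [smul_add, smul_smul, smul_smul, ← RCLike.ofReal_mul, ← RCLike.ofReal_mul,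
        mul_div_cancel₀ _ h.ne', mul_div_cancel₀ _ h.ne']

theorem IsDisk.dilationSet_smul (hB : IsDisk 𝕜 B) {x : X} {r : ℝ} (c : 𝕜)
    (hr : r ∈ dilationSet 𝕜 B x) : ‖c‖ * r ∈ dilationSet 𝕜 B (c • x) := by
  obtain ⟨h0, b, hb, rfl⟩ := hr
  refine ⟨by positivity, ?_⟩
  rcases eq_or_ne c 0 with rfl | hc
  · exact ⟨b, hb, by simp⟩
  · have hc' : (‖c‖ : 𝕜) ≠ 0 := by simpa using hc
    refine ⟨(c / (‖c‖ : 𝕜)) • b, hB.smul_mem hb ?_, ?_⟩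
    · simp [hc]
    · rw [smul_smul, smul_smul]
      congr 1
      push_cast
      field_simp

theorem IsDisk.zero_mem_dilationSet (hB : IsDisk 𝕜 B) {r : ℝ} (hr : 0 ≤ r) :
    r ∈ dilationSet 𝕜 B (0 : X) :=
  ⟨hr, 0, hB.zero_mem, by simp⟩

/-- The linear span of a disk. -/
def IsDisk.span (hB : IsDisk 𝕜 B) : Submodule 𝕜 X where
  carrier := {x | (dilationSet 𝕜 B x).Nonempty}
  add_mem' := fun ⟨_, hr⟩ ⟨_, hs⟩ => ⟨_, hB.dilationSet_add hr hs⟩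
  zero_mem' := ⟨0, hB.zero_mem_dilationSet le_rfl⟩
  smul_mem' := fun c _ ⟨_, hr⟩ => ⟨_, hB.dilationSet_smul c hr⟩

variable [TopologicalSpace X] [T2Space X] [ContinuousSMul 𝕜 X]

/-- Projection along the compact factor `B` is a closed map. Closedness makes the infimum defining
the gauge attained, so that the closed unit ball of the span is `B` itself. -/
theorem isClosed_dilationSet (hc : IsCompact B) (x : X) : IsClosed (dilationSet 𝕜 B x) := by
  have : CompactSpace B := isCompact_iff_compactSpace.1 hc
  have h : dilationSet 𝕜 B x =
      Set.Ici 0 ∩ Prod.fst '' {q : ℝ × B | x = (q.1 : 𝕜) • (q.2 : X)} := by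
    ext r
    simp [dilationSet]
  rw [h]
  refine isClosed_Ici.inter (isClosedMap_fst_of_compactSpace _ ?_)
  exact isClosed_eq continuous_const
    ((RCLike.continuous_ofReal.comp continuous_fst).smul (continuous_subtype_val.comp continuous_snd))

theorem sInf_dilationSet_mem (hc : IsCompact B) {x : X} (hx : (dilationSet 𝕜 B x).Nonempty) :
    sInf (dilationSet 𝕜 B x) ∈ dilationSet 𝕜 B x :=
  (isClosed_dilationSet hc x).csInf_mem hx ⟨0, fun _ h => h.1⟩

/-- The span of a compact disk, normed by the gauge of the disk. -/
noncomputable def IsDisk.normedSubspace (hB : IsDisk 𝕜 B) (hc : IsCompact B) :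
    NormedSubspace 𝕜 X where
  carrier := hB.span
  norm := Seminorm.ofSMulLE (fun x => sInf (dilationSet 𝕜 B (x : X)))
    (le_antisymm (csInf_le ⟨0, fun _ h => h.1⟩ (hB.zero_mem_dilationSet le_rfl))
      (Real.sInf_nonneg fun _ h => h.1))
    (fun x y => csInf_le ⟨0, fun _ h => h.1⟩
      (hB.dilationSet_add (sInf_dilationSet_mem hc x.2) (sInf_dilationSet_mem hc y.2)))
    (fun c x => csInf_le ⟨0, fun _ h => h.1⟩
      (hB.dilationSet_smul c (sInf_dilationSet_mem hc x.2)))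
  eq_zero_of_norm x hx := by
    obtain ⟨-, b, -, h⟩ := sInf_dilationSet_mem hc x.2
    have hx' : sInf (dilationSet 𝕜 B (x : X)) = 0 := hx
    rw [hx'] at h
    exact Subtype.ext (by simpa using h)

theorem IsDisk.norm_le_iff (hB : IsDisk 𝕜 B) (hc : IsCompact B)
    (e : (hB.normedSubspace hc).Space) (r : ℝ) :
    ‖e‖ ≤ r ↔ r ∈ dilationSet 𝕜 B ((hB.normedSubspace hc).incl e) :=
  ⟨fun h => hB.dilationSet_mono (sInf_dilationSet_mem hc e.2) h,
    fun h => csInf_le ⟨0, fun _ h => h.1⟩ h⟩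

theorem IsDisk.exists_incl_eq (hB : IsDisk 𝕜 B) (hc : IsCompact B) {x : X} {r : ℝ}
    (h : r ∈ dilationSet 𝕜 B x) :
    ∃ e : (hB.normedSubspace hc).Space, (hB.normedSubspace hc).incl e = x ∧ ‖e‖ ≤ r :=
  ⟨⟨x, r, h⟩, rfl, (hB.norm_le_iff hc _ _).2 h⟩

theorem IsDisk.image_closedBall (hB : IsDisk 𝕜 B) (hc : IsCompact B) :
    (hB.normedSubspace hc).incl '' Metric.closedBall 0 1 = B := by
  ext x
  constructor
  · rintro ⟨e, he, rfl⟩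
    rw [mem_closedBall_zero_iff, hB.norm_le_iff] at he
    obtain ⟨-, b, hb, h⟩ := he
    rw [h]
    simpa using hb
  · intro hx
    obtain ⟨e, he, h⟩ := hB.exists_incl_eq hc (x := x) (r := 1) ⟨zero_le_one, x, hx, by simp⟩
    exact ⟨e, by simpa using h, he⟩

end Disk

theorem NormedSubspace.incl_injective {𝕜 : Type*} [RCLike 𝕜] {X : Type*} [AddCommGroup X]
    [Module 𝕜 X] (E : NormedSubspace 𝕜 X) : Function.Injective E.incl :=
  Subtype.val_injective

/-- If the closed unit ball is compact in `X`, the inclusion is continuous. -/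
theorem NormedSubspace.continuous_incl {𝕜 : Type*} [RCLike 𝕜] {X : Type*} [AddCommGroup X]
    [Module 𝕜 X] [TopologicalSpace X] {p : SeminormFamily 𝕜 X ℕ} (hp : WithSeminorms p)
    (E : NormedSubspace 𝕜 X) (hE : IsCompact (E.incl '' Metric.closedBall 0 1)) :
    Continuous E.incl := by
  have := hp.topologicalAddGroup
  refine WithSeminorms.continuous_normedSpace_dom E.Space hp E.incl fun n => ?_
  obtain ⟨C, hC⟩ := hE.bddAbove_image (hp.continuous_seminorm n).continuousOn
  have hC' : ∀ e : E.Space, ‖e‖ ≤ 1 → p n (E.incl e) ≤ C := fun e he =>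
    hC ⟨_, ⟨e, by simpa using he, rfl⟩, rfl⟩
  have hC0 : 0 ≤ C := (apply_nonneg _ _).trans (hC' 0 (by simp))
  refine ⟨⟨C, hC0⟩, fun e => ?_⟩
  rcases eq_or_ne e 0 with rfl | he
  · simp
  have hn : (0 : ℝ) < ‖e‖ := norm_pos_iff.2 he
  have h := hC' (((‖e‖⁻¹ : ℝ) : 𝕜) • e) (by
    rw [norm_smul, RCLike.norm_ofReal, abs_of_nonneg (by positivity), inv_mul_cancel₀ hn.ne'])
  rw [map_smul, map_smul_eq_mul, RCLike.norm_ofReal, abs_of_nonneg (by positivity),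
    inv_mul_le_iff₀ hn] at h
  change p n (E.incl e) ≤ C * ‖e‖
  linarith

/-- A compact disk in a complete space spans a Banach space. -/
theorem IsDisk.completeSpace {𝕜 : Type*} [RCLike 𝕜] {X : Type*} [AddCommGroup X]
    [Module 𝕜 X] [UniformSpace X] [IsUniformAddGroup X] [T2Space X] [CompleteSpace X]
    [ContinuousSMul 𝕜 X] {p : SeminormFamily 𝕜 X ℕ} (hp : WithSeminorms p) {B : Set X}
    (hB : IsDisk 𝕜 B) (hc : IsCompact B) : CompleteSpace (hB.normedSubspace hc).Space := by
  set E := hB.normedSubspace hc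
  have hcont : Continuous E.incl :=
    E.continuous_incl hp (by rw [hB.image_closedBall hc]; exact hc)
  have huc : UniformContinuous E.incl :=
    uniformContinuous_addMonoidHom_of_continuous (f := E.incl.toAddMonoidHom) hcont
  refine Metric.complete_of_cauchySeq_tendsto fun u hu => ?_
  obtain ⟨x, hx⟩ := cauchySeq_tendsto_of_complete (huc.comp_cauchySeq hu)
  -- A norm bound by `ε` is membership in `ε • B`, a closed set of `X`; hence the Cauchy estimates
  -- survive passage to the limit in `X`.
  have key : ∀ ε > 0, ∃ N, ∀ n ≥ N, ε ∈ dilationSet 𝕜 B (x - E.incl (u n)) := by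
    intro ε hε
    obtain ⟨N, hN⟩ := Metric.cauchySeq_iff.1 hu ε hε
    refine ⟨N, fun n hn => ⟨hε.le, ((ε⁻¹ : ℝ) : 𝕜) • (x - E.incl (u n)), ?_, ?_⟩⟩
    · have hl : Tendsto (fun m => ((ε⁻¹ : ℝ) : 𝕜) • (E.incl (u m) - E.incl (u n))) atTop
          (𝓝 (((ε⁻¹ : ℝ) : 𝕜) • (x - E.incl (u n)))) := (hx.sub_const _).const_smul _
      refine hc.isClosed.mem_of_tendsto hl ?_
      filter_upwards [eventually_ge_atTop N] with m hm
      have h := (hN m hm n hn).le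
      rw [dist_eq_norm, hB.norm_le_iff hc, map_sub] at h
      obtain ⟨-, b, hb, h⟩ := h
      rw [h, smul_smul, ← RCLike.ofReal_mul, inv_mul_cancel₀ hε.ne']
      simpa using hb
    · rw [smul_smul, ← RCLike.ofReal_mul, mul_inv_cancel₀ hε.ne']
      simp
  obtain ⟨N, hN⟩ := key 1 one_pos
  obtain ⟨e, he, -⟩ := hB.exists_incl_eq hc (hN N le_rfl)
  refine ⟨e + u N, Metric.tendsto_atTop.2 fun ε hε => ?_⟩
  obtain ⟨N', hN'⟩ := key (ε / 2) (by positivity)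
  refine ⟨N', fun n hn => ?_⟩
  have hx' : x = E.incl (e + u N) := by rw [map_add, he]; abel
  have h := hN' n hn
  rw [hx', ← map_sub, ← hB.norm_le_iff hc, ← dist_eq_norm, dist_comm] at h
  linarith

/-! ### A criterion for reflexivity -/

/-- Helly's theorem: if the unit ball is mapped onto a compact set by finitely many functionals,
every element of the unit ball of the bidual is represented on them by a point of the ball. -/
theorem exists_mem_closedBall_forall_eq {𝕜 : Type*} [RCLike 𝕜] {F : Type*}
    [NormedAddCommGroup F] [NormedSpace 𝕜 F] (ξ : StrongDual 𝕜 (StrongDual 𝕜 F)) (hξ : ‖ξ‖ ≤ 1)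
    (s : Finset (StrongDual 𝕜 F))
    (hs : IsCompact ((fun (x : F) (φ : s) => (φ : StrongDual 𝕜 F) x) '' Metric.closedBall 0 1)) :
    ∃ x ∈ Metric.closedBall (0 : F) 1, ∀ φ ∈ s, φ x = ξ φ := by
  classical
  let : NormedSpace ℝ F := NormedSpace.restrictScalars ℝ 𝕜 F
  have : IsScalarTower ℝ 𝕜 F := RestrictScalars.isScalarTower ℝ 𝕜 F
  set L : F →ₗ[ℝ] (s → 𝕜) :=
    { toFun := fun x φ => (φ : StrongDual 𝕜 F) x
      map_add' := fun x y => by ext; simp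
      map_smul' := fun c x => by
        ext φ
        change (φ : StrongDual 𝕜 F) (c • x) = c • (φ : StrongDual 𝕜 F) x
        rw [RCLike.real_smul_eq_coe_smul (K := 𝕜) c x, map_smul,
          RCLike.real_smul_eq_coe_smul (K := 𝕜)] } with hL
  have hconv : Convex ℝ (L '' Metric.closedBall 0 1) :=
    (convex_closedBall (0 : F) 1).linear_image L
  by_contra! hcon
  have hnot : (fun φ : s => ξ φ) ∉ L '' Metric.closedBall 0 1 := by
    rintro ⟨x, hx, h⟩
    obtain ⟨φ, hφ, hne⟩ := hcon x hx
    exact hne (congrFun h ⟨φ, hφ⟩)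
  obtain ⟨f, u, hu, hlt⟩ := RCLike.geometric_hahn_banach_closed_point (𝕜 := 𝕜) hconv
    (IsCompact.isClosed hs) hnot
  -- The separating functional pulled back to `F`: `ψ = f ∘ L`. Separation will give `‖ψ‖ ≤ u < re
  -- (ξ ψ)`, against `‖ξ‖ ≤ 1`.
  set ψ : StrongDual 𝕜 F := ∑ φ : s, f (Pi.single φ 1) • (φ : StrongDual 𝕜 F) with hψ
  have hf : ∀ v : s → 𝕜, f v = ∑ φ : s, f (Pi.single φ 1) * v φ := by
    intro v
    conv_lhs => rw [← Finset.univ_sum_single v, map_sum]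
    refine Finset.sum_congr rfl fun φ _ => ?_
    have : (Pi.single φ (v φ) : s → 𝕜) = v φ • Pi.single φ 1 := by
      rw [← Pi.single_smul]; simp
    rw [this, map_smul, smul_eq_mul, mul_comm]
  have hψx : ∀ x, ψ x = f (L x) := fun x => by
    rw [hf, hψ]; simp [hL]
  have hξψ : ξ ψ = f (fun φ : s => ξ φ) := by
    rw [hf, hψ, map_sum]; simp
  have hu0 : 0 < u := by
    have := hu 0 ⟨0, by simp, by simp⟩
    simpa using this
  have hball : ∀ x : F, ‖x‖ ≤ 1 → ‖ψ x‖ ≤ u := by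
    intro x hx
    rcases eq_or_ne (ψ x) 0 with h0 | h0
    · rw [h0, norm_zero]; exact hu0.le
    have hn : (‖ψ x‖ : 𝕜) ≠ 0 := by simpa using h0
    -- Rotating `x` by the conjugate phase turns `ψ x` into `‖ψ x‖`, so the bound on real parts
    -- bounds the modulus.
    have h1 := hu _ ⟨((starRingEnd 𝕜) (ψ x) / (‖ψ x‖ : 𝕜)) • x, by
      simp [norm_smul, h0, hx], rfl⟩
    rw [← hψx, map_smul, smul_eq_mul, div_mul_eq_mul_div, RCLike.conj_mul, pow_two,
      mul_div_assoc, div_self hn, mul_one, RCLike.ofReal_re] at h1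
    exact h1.le
  have hnorm : ‖ψ‖ ≤ u :=
    ContinuousLinearMap.opNorm_le_of_unit_norm hu0.le fun x hx => hball x hx.le
  have h2 : RCLike.re (ξ ψ) ≤ u := calc
    RCLike.re (ξ ψ) ≤ ‖ξ ψ‖ := RCLike.re_le_norm _
    _ ≤ ‖ξ‖ * ‖ψ‖ := ξ.le_opNorm _
    _ ≤ 1 * u := by gcongr
    _ = u := one_mul u
  rw [hξψ] at h2
  linarith

/-- A normed space is reflexive if its unit ball is the image of a compact space under a map
whose composition with every bounded functional is continuous. -/
theorem isReflexiveSpace_of_compact_parametrization {𝕜 : Type*} [RCLike 𝕜] {F : Type*}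
    [NormedAddCommGroup F] [NormedSpace 𝕜 F] {S : Type*} [TopologicalSpace S] [CompactSpace S]
    (g : S → F) (hg : Set.range g = Metric.closedBall 0 1)
    (hcont : ∀ φ : StrongDual 𝕜 F, Continuous fun s => φ (g s)) : IsReflexiveSpace 𝕜 F := by
  have hball : ∀ ξ : StrongDual 𝕜 (StrongDual 𝕜 F), ‖ξ‖ ≤ 1 →
      ∃ x, NormedSpace.inclusionInDoubleDual 𝕜 F x = ξ := by
    intro ξ hξ
    -- These sets are closed in the compact space `S`, and Helly's theorem supplies the finite
    -- intersection property.
    have hne : (⋂ φ : StrongDual 𝕜 F, {s | φ (g s) = ξ φ}).Nonempty := by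
      by_contra hemp
      rw [Set.not_nonempty_iff_eq_empty] at hemp
      obtain ⟨t, ht⟩ := isCompact_univ.elim_finite_subfamily_closed
        (fun φ : StrongDual 𝕜 F => {s | φ (g s) = ξ φ})
        (fun φ => isClosed_eq (hcont φ) continuous_const)
        (by rw [hemp, Set.univ_inter])
      obtain ⟨x, hx, hxt⟩ := exists_mem_closedBall_forall_eq ξ hξ t (by
        rw [← hg, ← Set.range_comp]
        exact isCompact_range (continuous_pi fun φ => hcont φ))
      rw [← hg] at hx
      obtain ⟨s, rfl⟩ := hx
      have : s ∈ ⋂ φ ∈ t, {s | φ (g s) = ξ φ} := by simpa using hxt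
      rw [Set.univ_inter] at ht
      rw [ht] at this
      exact this
    obtain ⟨s, hs⟩ := hne
    rw [Set.mem_iInter] at hs
    exact ⟨g s, by ext φ; simpa using hs φ⟩
  intro ξ
  have hpos : 0 < ‖ξ‖ + 1 := by positivity
  have hn : ((‖ξ‖ + 1 : ℝ) : 𝕜) ≠ 0 := RCLike.ofReal_ne_zero.2 hpos.ne'
  obtain ⟨x, hx⟩ := hball (((‖ξ‖ + 1 : ℝ) : 𝕜)⁻¹ • ξ) (by
    refine (ContinuousLinearMap.opNorm_smul_le _ _).trans ?_
    rw [norm_inv, RCLike.norm_ofReal, abs_of_pos hpos, inv_mul_le_iff₀ hpos]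
    linarith)
  exact ⟨((‖ξ‖ + 1 : ℝ) : 𝕜) • x, by rw [map_smul, hx, smul_smul, mul_inv_cancel₀ hn, one_smul]⟩

/-! ### Square-summable series of blocks -/

/-- The sequences `z` with `∑ ‖z k‖ ^ 2 ≤ c ^ 2`. -/
def squareSumBall (Y : ℕ → Type*) [∀ k, NormedAddCommGroup (Y k)] (c : ℝ) : Set (∀ k, Y k) :=
  {z | ∀ t : Finset ℕ, ∑ k ∈ t, ‖z k‖ ^ 2 ≤ c ^ 2}

section SquareSum

variable {𝕜 : Type*} [RCLike 𝕜] {Y : ℕ → Type*} [∀ k, NormedAddCommGroup (Y k)]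
  [∀ k, NormedSpace 𝕜 (Y k)]

theorem norm_le_of_mem_squareSumBall {c : ℝ} (hc : 0 ≤ c) {z : ∀ k, Y k}
    (hz : z ∈ squareSumBall Y c) (k : ℕ) : ‖z k‖ ≤ c := by
  have := hz {k}
  rw [Finset.sum_singleton] at this
  exact le_of_sq_le_sq this hc

theorem isCompact_setOf_norm_le [∀ k, ProperSpace (Y k)] (c : ℕ → ℝ) :
    IsCompact {z : ∀ k, Y k | ∀ k, ‖z k‖ ≤ c k} := by
  have h : {z : ∀ k, Y k | ∀ k, ‖z k‖ ≤ c k} =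
      Set.pi Set.univ fun k => Metric.closedBall (0 : Y k) (c k) := by
    ext z; simp [Set.mem_pi]
  rw [h]
  exact isCompact_univ_pi fun k => isCompact_closedBall 0 (c k)

theorem isCompact_squareSumBall [∀ k, ProperSpace (Y k)] {c : ℝ} (hc : 0 ≤ c) :
    IsCompact (squareSumBall Y c) := by
  refine (isCompact_setOf_norm_le (Y := Y) fun _ => c).of_isClosed_subset ?_
    fun z hz => norm_le_of_mem_squareSumBall hc hz
  rw [squareSumBall, Set.ofPred_forall]
  exact isClosed_iInter fun t => isClosed_le
    (continuous_finsetSum _ fun k _ => ((continuous_apply k).norm.pow 2)) continuous_const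

theorem isDisk_squareSumBall : IsDisk 𝕜 (squareSumBall Y 1) where
  zero_mem := fun t => by simp
  combo_mem z hz w hw a b hab t := by
    -- Convexity of the square: `(a + b) * (a * x ^ 2 + b * y ^ 2)` exceeds `(a * x + b * y) ^ 2` by
    -- `a * b * (x - y) ^ 2`.
    have key : ∀ k, ‖(a • z + b • w) k‖ ^ 2 ≤ ‖a‖ * ‖z k‖ ^ 2 + ‖b‖ * ‖w k‖ ^ 2 := by
      intro k
      have h1 : ‖(a • z + b • w) k‖ ≤ ‖a‖ * ‖z k‖ + ‖b‖ * ‖w k‖ := by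
        refine (norm_add_le _ _).trans ?_
        simp [norm_smul]
      have ha := norm_nonneg a
      have hb := norm_nonneg b
      calc ‖(a • z + b • w) k‖ ^ 2 ≤ (‖a‖ * ‖z k‖ + ‖b‖ * ‖w k‖) ^ 2 := by gcongr
        _ ≤ (‖a‖ + ‖b‖) * (‖a‖ * ‖z k‖ ^ 2 + ‖b‖ * ‖w k‖ ^ 2) := by
          nlinarith [mul_nonneg (mul_nonneg ha hb) (sq_nonneg (‖z k‖ - ‖w k‖))]
        _ ≤ 1 * (‖a‖ * ‖z k‖ ^ 2 + ‖b‖ * ‖w k‖ ^ 2) := by gcongr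
        _ = _ := one_mul _
    calc ∑ k ∈ t, ‖(a • z + b • w) k‖ ^ 2
        ≤ ∑ k ∈ t, (‖a‖ * ‖z k‖ ^ 2 + ‖b‖ * ‖w k‖ ^ 2) := Finset.sum_le_sum fun k _ => key k
      _ = ‖a‖ * ∑ k ∈ t, ‖z k‖ ^ 2 + ‖b‖ * ∑ k ∈ t, ‖w k‖ ^ 2 := by
        rw [Finset.sum_add_distrib, Finset.mul_sum, Finset.mul_sum]
      _ ≤ ‖a‖ * 1 ^ 2 + ‖b‖ * 1 ^ 2 := by gcongr <;> [exact hz t; exact hw t]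
      _ ≤ 1 ^ 2 := by simpa using hab

theorem inv_smul_mem_squareSumBall {c : ℝ} (hc : 0 < c) {z : ∀ k, Y k}
    (hz : z ∈ squareSumBall Y c) : ((c⁻¹ : ℝ) : 𝕜) • z ∈ squareSumBall Y 1 := by
  intro t
  have h : ∀ k, ‖(((c⁻¹ : ℝ) : 𝕜) • z) k‖ ^ 2 = (c ^ 2)⁻¹ * ‖z k‖ ^ 2 := fun k => by
    rw [Pi.smul_apply, norm_smul, RCLike.norm_ofReal, abs_of_pos (inv_pos.2 hc), mul_pow, inv_pow]
  simp_rw [h]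
  rw [← Finset.mul_sum, inv_mul_le_iff₀ (by positivity)]
  simpa using hz t

end SquareSum

/-! ### Uniform convergence of series, tested seminorm by seminorm -/

section UniformCauchy

variable {𝕜 : Type*} [RCLike 𝕜] {X : Type*} [AddCommGroup X] [Module 𝕜 X] [UniformSpace X]
  [IsUniformAddGroup X] {ι : Type*} {p : SeminormFamily 𝕜 X ι}

theorem WithSeminorms.exists_forall_lt_mem_of_mem_uniformity (hp : WithSeminorms p)
    {u : Set (X × X)} (hu : u ∈ uniformity X) :
    ∃ (s : Finset ι) (r : ℝ), 0 < r ∧ ∀ x y, (∀ i ∈ s, p i (y - x) < r) → (x, y) ∈ u := by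
  rw [uniformity_eq_comap_nhds_zero, mem_comap] at hu
  obtain ⟨V, hV, hVu⟩ := hu
  obtain ⟨⟨s, r⟩, hr, hsub⟩ := hp.hasBasis_zero_ball.mem_iff.1 hV
  refine ⟨s, r, hr, fun x y h => hVu (hsub ?_)⟩
  rw [Seminorm.mem_ball_zero]
  exact Seminorm.finset_sup_apply_lt hr h

/-- Series whose tails are uniformly small in every seminorm are uniformly Cauchy. -/
theorem WithSeminorms.uniformCauchySeqOn_sum (hp : WithSeminorms p) {α : Type*} {S : Set α}
    (f : ℕ → α → X) (h : ∀ i, ∃ a : ℕ → ℝ, Tendsto a atTop (𝓝 0) ∧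
      ∀ M N, M ≤ N → ∀ z ∈ S, p i (∑ k ∈ Finset.Ico M N, f k z) ≤ a M) :
    UniformCauchySeqOn (fun N z => ∑ k ∈ Finset.range N, f k z) atTop S := by
  intro u hu
  obtain ⟨s, r, hr, hsu⟩ := hp.exists_forall_lt_mem_of_mem_uniformity hu
  choose a ha hab using h
  have h1 : ∀ᶠ m in atTop, ∀ i ∈ s, a i m < r :=
    (Filter.eventually_all_finset s).2 fun i _ => (ha i).eventually_lt_const hr
  filter_upwards [h1.prod_mk h1] with m hm z hz
  refine hsu _ _ fun i hi => ?_
  rcases le_total m.1 m.2 with hle | hle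
  · rw [← Finset.sum_Ico_eq_sub _ hle]
    exact (hab i _ _ hle z hz).trans_lt (hm.1 i hi)
  · rw [map_sub_rev, ← Finset.sum_Ico_eq_sub _ hle]
    exact (hab i _ _ hle z hz).trans_lt (hm.2 i hi)

end UniformCauchy

/-- Finite sums over `[M, N)` of a nonnegative summable sequence are at most its tail. -/
theorem Summable.sum_Ico_le_tsum_add {c : ℕ → ℝ} (hc : Summable c) (h0 : ∀ k, 0 ≤ c k) (M N : ℕ) :
    ∑ k ∈ Finset.Ico M N, c k ≤ ∑' k, c (k + M) := by
  rw [Finset.sum_Ico_eq_sum_range]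
  simp_rw [add_comm M]
  exact ((summable_nat_add_iff M).2 hc).sum_le_tsum _ fun k _ => h0 _

/-! ### Square-summable series in a Banach space -/

section Banach

variable {𝕜 : Type*} [RCLike 𝕜] {Y : ℕ → Type*} [∀ k, NormedAddCommGroup (Y k)]
  [∀ k, NormedSpace 𝕜 (Y k)] {F : Type*} [NormedAddCommGroup F] [NormedSpace 𝕜 F]

/-- A vector of the unit ball that almost norms `f` is rotated so that its value is real. The factor
`1 / 2` is there because the norm need not be attained. -/
theorem ContinuousLinearMap.exists_apply_eq_ofReal_half_norm_le {V : Type*} [NormedAddCommGroup V]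
    [NormedSpace 𝕜 V] (f : V →L[𝕜] 𝕜) :
    ∃ (y : V) (r : ℝ), ‖y‖ ≤ 1 ∧ f y = (r : 𝕜) ∧ ‖f‖ / 2 ≤ r := by
  rcases (norm_nonneg f).eq_or_lt with h | h
  · exact ⟨0, 0, by simp, by simp, by simp [← h]⟩
  obtain ⟨x, hx, hr⟩ := f.exists_lt_apply_of_lt_opNorm (half_lt_self h)
  have h0 : f x ≠ 0 := norm_pos_iff.1 (lt_trans (by positivity) hr)
  have hn : (‖f x‖ : 𝕜) ≠ 0 := by simpa using h0
  refine ⟨((starRingEnd 𝕜) (f x) / (‖f x‖ : 𝕜)) • x, ‖f x‖, ?_, ?_, hr.le⟩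
  · simpa [norm_smul, h0] using hx.le
  · rw [map_smul, smul_eq_mul, div_mul_eq_mul_div, RCLike.conj_mul, pow_two,
      mul_div_assoc, div_self hn, mul_one]

/-- The maps `σ k` combine to a contraction from the square-summable sum of the spaces `Y k`. -/
def IsBlockContraction (σ : ∀ k, Y k →L[𝕜] F) : Prop :=
  ∀ (t : Finset ℕ) (y : ∀ k, Y k), ‖∑ k ∈ t, σ k (y k)‖ ^ 2 ≤ ∑ k ∈ t, ‖y k‖ ^ 2

variable {σ : ∀ k, Y k →L[𝕜] F}

theorem norm_block_le (hσ : IsBlockContraction σ) (k : ℕ) (y : Y k) : ‖σ k y‖ ≤ ‖y‖ := by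
  classical
  have := hσ {k} (Pi.single k y)
  simp only [Finset.sum_singleton, Pi.single_eq_same] at this
  exact le_of_sq_le_sq this (norm_nonneg _)

theorem summable_block [CompleteSpace F] (hσ : IsBlockContraction σ) {c : ℝ} {z : ∀ k, Y k}
    (hz : z ∈ squareSumBall Y c) :
    Summable fun k => σ k (z k) := by
  have hs : Summable fun k => ‖z k‖ ^ 2 := summable_of_sum_le (fun k => by positivity) hz
  rw [summable_iff_vanishing_norm] at hs ⊢
  intro ε hε
  obtain ⟨s, h⟩ := hs (ε ^ 2) (by positivity)
  refine ⟨s, fun t ht => lt_of_pow_lt_pow_left₀ 2 hε.le ?_⟩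
  exact (hσ t z).trans_lt ((le_abs_self _).trans_lt (h t ht))

/-- Duality of `ℓ²`: with `s k = ‖φ ∘ σ k‖` and nearly norming `y k`, test `φ` on `v = ∑ s k • σ k
(y k)`. If `A = ∑ s k ^ 2`, then `‖v‖ ^ 2 ≤ A` and `A / 2 ≤ φ v`, so `A ≤ 4 * ‖φ‖ ^ 2`. -/
theorem summable_sq_norm_comp_block (hσ : IsBlockContraction σ) (φ : F →L[𝕜] 𝕜) :
    Summable fun k => ‖φ.comp (σ k)‖ ^ 2 := by
  choose y r hy hr hle using fun k => (φ.comp (σ k)).exists_apply_eq_ofReal_half_norm_le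
  refine summable_of_sum_le (c := 4 * ‖φ‖ ^ 2) (fun k => by positivity) fun t => ?_
  set s : ℕ → ℝ := fun k => ‖φ.comp (σ k)‖ with hs
  set A := ∑ k ∈ t, s k ^ 2 with hA
  have hs0 : ∀ k, 0 ≤ s k := fun k => norm_nonneg _
  have hA0 : 0 ≤ A := Finset.sum_nonneg fun k _ => by positivity
  set v := ∑ k ∈ t, σ k (((s k : ℝ) : 𝕜) • y k) with hv
  have hvA : ‖v‖ ^ 2 ≤ A := (hσ t fun k => ((s k : ℝ) : 𝕜) • y k).trans <|
    Finset.sum_le_sum fun k _ => by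
      rw [norm_smul, RCLike.norm_ofReal, abs_of_nonneg (hs0 k)]
      have : s k * ‖y k‖ ≤ s k := mul_le_of_le_one_right (hs0 k) (hy k)
      have := hs0 k
      gcongr
  have hφv : φ v = ((∑ k ∈ t, s k * r k : ℝ) : 𝕜) := by
    rw [hv, map_sum, RCLike.ofReal_sum]
    refine Finset.sum_congr rfl fun k _ => ?_
    have := hr k
    rw [ContinuousLinearMap.comp_apply] at this
    rw [map_smul, map_smul, this, RCLike.ofReal_mul, smul_eq_mul]
  have h1 : A / 2 ≤ ∑ k ∈ t, s k * r k := by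
    rw [hA, Finset.sum_div]
    refine Finset.sum_le_sum fun k _ => ?_
    have := mul_le_mul_of_nonneg_left (hle k) (hs0 k)
    calc s k ^ 2 / 2 = s k * (s k / 2) := by ring
      _ ≤ s k * r k := this
  have h2 : A / 2 ≤ ‖φ‖ * ‖v‖ := by
    refine h1.trans ((le_abs_self _).trans ?_)
    rw [← RCLike.norm_ofReal (K := 𝕜), ← hφv]
    exact φ.le_opNorm v
  have h3 : (A / 2) ^ 2 ≤ (‖φ‖ * ‖v‖) ^ 2 := by gcongr
  have h4 : A ^ 2 ≤ 4 * ‖φ‖ ^ 2 * A := by nlinarith [sq_nonneg ‖φ‖]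
  rcases hA0.eq_or_lt with h | h
  · rw [← h]; positivity
  · rw [pow_two] at h4
    exact le_of_mul_le_mul_right h4 h

/-- By Cauchy–Schwarz the tails of `∑ φ (σ k (z k))` are bounded, uniformly on the ball, by the
`ℓ²`-tails of `‖φ ∘ σ k‖`. Together with compactness of the ball this is weak compactness of its
image. -/
theorem continuousOn_apply_tsum_block [CompleteSpace F] (hσ : IsBlockContraction σ)
    (φ : F →L[𝕜] 𝕜) :
    ContinuousOn (fun z : ∀ k, Y k => φ (∑' k, σ k (z k))) (squareSumBall Y 1) := by
  have hs := summable_sq_norm_comp_block hσ φ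
  have hU : UniformCauchySeqOn (fun N (z : ∀ k, Y k) => ∑ k ∈ Finset.range N, φ (σ k (z k)))
      atTop (squareSumBall Y 1) := by
    refine (norm_withSeminorms 𝕜 𝕜).uniformCauchySeqOn_sum
      (fun k (z : ∀ k, Y k) => φ (σ k (z k))) fun _ =>
      ⟨fun M => √(∑' k, ‖φ.comp (σ (k + M))‖ ^ 2), ?_, fun M N _ z hz => ?_⟩
    · simpa using (tendsto_sum_nat_add fun k => ‖φ.comp (σ k)‖ ^ 2).sqrt
    · change ‖∑ k ∈ Finset.Ico M N, φ (σ k (z k))‖ ≤ _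
      refine Real.le_sqrt_of_sq_le ?_
      calc ‖∑ k ∈ Finset.Ico M N, φ (σ k (z k))‖ ^ 2
          ≤ (∑ k ∈ Finset.Ico M N, ‖φ.comp (σ k)‖ * ‖z k‖) ^ 2 := by
            gcongr
            exact norm_sum_le_of_le _ fun k _ => (φ.comp (σ k)).le_opNorm (z k)
        _ ≤ (∑ k ∈ Finset.Ico M N, ‖φ.comp (σ k)‖ ^ 2) * ∑ k ∈ Finset.Ico M N, ‖z k‖ ^ 2 :=
            Finset.sum_mul_sq_le_sq_mul_sq _ _ _
        _ ≤ (∑' k, ‖φ.comp (σ (k + M))‖ ^ 2) * 1 ^ 2 := by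
            gcongr
            · exact hs.sum_Ico_le_tsum_add (fun k => by positivity) M N
            · exact hz _
        _ = _ := by ring
  have hT := hU.tendstoUniformlyOn_of_tendsto
      (f := fun z : ∀ k, Y k => φ (∑' k, σ k (z k))) fun z hz => by
    have := ((summable_block hσ hz).hasSum.mapL φ).tendsto_sum_nat
    exact this
  refine hT.continuousOn (Frequently.of_forall fun N => Continuous.continuousOn ?_)
  exact continuous_finsetSum _ fun k _ => φ.continuous.comp ((σ k).continuous.comp
    (continuous_apply k))

/-- With a summable bound on the coordinates the series converges uniformly in norm, so summation is
norm continuous on a compact product of balls. -/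
theorem isCompact_image_tsum_block [CompleteSpace F] [∀ k, ProperSpace (Y k)]
    (hσ : IsBlockContraction σ) {c : ℕ → ℝ} (hc : Summable c) :
    IsCompact ((fun z : ∀ k, Y k => ∑' k, σ k (z k)) '' {z | ∀ k, ‖z k‖ ≤ c k}) :=
  (isCompact_setOf_norm_le c).image_of_continuousOn <|
    continuousOn_tsum (fun k => ((σ k).continuous.comp (continuous_apply k)).continuousOn) hc
      fun k z hz => (norm_block_le hσ k (z k)).trans (hz k)

theorem separableSpace_of_block [CompleteSpace F] [∀ k, ProperSpace (Y k)]
    (hσ : IsBlockContraction σ)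
    (hball : Metric.closedBall (0 : F) 1 ⊆
      (fun z : ∀ k, Y k => ∑' k, σ k (z k)) '' squareSumBall Y 1) :
    TopologicalSpace.SeparableSpace F := by
  set V : Submodule 𝕜 F := Submodule.span 𝕜 (⋃ k, Set.range (σ k)) with hV
  have hsep : TopologicalSpace.IsSeparable (closure (V : Set F)) :=
    (TopologicalSpace.IsSeparable.iUnion fun k =>
      TopologicalSpace.isSeparable_range (σ k).continuous).span.closure
  rw [← TopologicalSpace.isSeparable_univ_iff]
  refine hsep.mono fun x _ => ?_
  have hmem : ∀ x : F, ‖x‖ ≤ 1 → x ∈ V.topologicalClosure := by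
    intro x hx
    obtain ⟨z, hz, rfl⟩ := hball (mem_closedBall_zero_iff.2 hx)
    refine mem_closure_of_tendsto (summable_block hσ hz).hasSum.tendsto_sum_nat
      (Eventually.of_forall fun N => ?_)
    exact V.sum_mem fun k _ => Submodule.subset_span (Set.mem_iUnion.2 ⟨k, _, rfl⟩)
  have hpos : 0 < ‖x‖ + 1 := by positivity
  have h := hmem (((‖x‖ + 1 : ℝ) : 𝕜)⁻¹ • x) (by
    rw [norm_smul, norm_inv, RCLike.norm_ofReal, abs_of_pos hpos, inv_mul_le_iff₀ hpos]
    linarith)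
  have h' := V.topologicalClosure.smul_mem ((‖x‖ + 1 : ℝ) : 𝕜) h
  rwa [smul_smul, mul_inv_cancel₀ (RCLike.ofReal_ne_zero.2 hpos.ne'), one_smul] at h'

theorem isReflexiveSpace_of_block [CompleteSpace F] [∀ k, ProperSpace (Y k)]
    (hσ : IsBlockContraction σ)
    (hball : (fun z : ∀ k, Y k => ∑' k, σ k (z k)) '' squareSumBall Y 1 =
      Metric.closedBall (0 : F) 1) :
    IsReflexiveSpace 𝕜 F := by
  have : CompactSpace (squareSumBall Y 1) :=
    isCompact_iff_compactSpace.1 (isCompact_squareSumBall zero_le_one)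
  refine isReflexiveSpace_of_compact_parametrization
    (fun z : squareSumBall Y 1 => ∑' k, σ k (z.1 k)) ?_ fun φ => ?_
  · rw [← hball, Set.image_eq_range]
  · exact continuousOn_iff_continuous_domRestrict.1 (continuousOn_apply_tsum_block hσ φ)

end Banach

theorem Seminorm.sum_le {𝕜 X ι : Type*} [SeminormedRing 𝕜] [AddCommGroup X] [Module 𝕜 X]
    (q : Seminorm 𝕜 X) (s : Finset ι) (f : ι → X) : q (∑ i ∈ s, f i) ≤ ∑ i ∈ s, q (f i) :=
  Finset.le_sum_of_subadditive q (map_zero q).le (map_add_le_add q) s f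

/-! ### Reflexive spaces of square-summable series in a Fréchet space -/

section Series

variable {𝕜 : Type*} [RCLike 𝕜] {X : Type*} [AddCommGroup X] [Module 𝕜 X]
  {Y : ℕ → Type*} [∀ k, NormedAddCommGroup (Y k)] [∀ k, NormedSpace 𝕜 (Y k)]

/-- The norms of the linear maps `τ k` are summable with respect to each of the seminorms. -/
def SummablyBounded (p : SeminormFamily 𝕜 X ℕ) (τ : ∀ k, Y k →ₗ[𝕜] X) : Prop :=
  ∀ n, ∃ c : ℕ → ℝ, (∀ k, 0 ≤ c k) ∧ Summable c ∧ ∀ k y, p n (τ k y) ≤ c k * ‖y‖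

/-- The sums of the series `∑ τ k (z k)` with `∑ ‖z k‖ ^ 2 ≤ 1`. -/
def seriesDisk [TopologicalSpace X] (τ : ∀ k, Y k →ₗ[𝕜] X) : Set X :=
  {x | ∃ z ∈ squareSumBall Y 1,
    Tendsto (fun N => ∑ k ∈ Finset.range N, τ k (z k)) atTop (𝓝 x)}

theorem SummablyBounded.continuous [TopologicalSpace X] {p : SeminormFamily 𝕜 X ℕ}
    {τ : ∀ k, Y k →ₗ[𝕜] X} (hτ : SummablyBounded p τ)
    (hp : WithSeminorms p) (k : ℕ) : Continuous (τ k) := by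
  refine WithSeminorms.continuous_normedSpace_dom (Y k) hp (τ k) fun n => ?_
  obtain ⟨c, hc, -, h⟩ := hτ n
  exact ⟨⟨c k, hc k⟩, fun y => h k y⟩

section Topological

variable [TopologicalSpace X] [T2Space X] [ContinuousSMul 𝕜 X]
  {τ : ∀ k, Y k →ₗ[𝕜] X}

theorem mem_dilationSet_seriesDisk {c : ℝ} (hc : 0 ≤ c) {z : ∀ k, Y k}
    (hz : z ∈ squareSumBall Y c) {x : X}
    (hx : Tendsto (fun N => ∑ k ∈ Finset.range N, τ k (z k)) atTop (𝓝 x)) :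
    c ∈ dilationSet 𝕜 (seriesDisk τ) x := by
  rcases hc.eq_or_lt with rfl | hc
  · have hz0 : ∀ k, z k = 0 := fun k =>
      norm_le_zero_iff.1 (norm_le_of_mem_squareSumBall le_rfl hz k)
    simp only [hz0, map_zero, Finset.sum_const_zero] at hx
    exact ⟨le_rfl, 0, ⟨0, (isDisk_squareSumBall (𝕜 := 𝕜)).zero_mem, by simp⟩,
      by rw [smul_zero]; exact tendsto_nhds_unique hx tendsto_const_nhds⟩
  · refine ⟨hc.le, ((c⁻¹ : ℝ) : 𝕜) • x, ⟨_, inv_smul_mem_squareSumBall (𝕜 := 𝕜) hc hz, ?_⟩, ?_⟩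
    · simpa [Finset.smul_sum] using hx.const_smul ((c⁻¹ : ℝ) : 𝕜)
    · rw [smul_smul, ← RCLike.ofReal_mul, mul_inv_cancel₀ hc.ne']
      simp

/-- Extending `y` by zero outside `t` gives an admissible series. This is the estimate that makes
the blocks a contraction into the span of the disk. -/
theorem sum_mem_dilationSet_seriesDisk (t : Finset ℕ) (y : ∀ k, Y k) :
    √(∑ k ∈ t, ‖y k‖ ^ 2) ∈ dilationSet 𝕜 (seriesDisk τ) (∑ k ∈ t, τ k (y k)) := by
  classical
  refine mem_dilationSet_seriesDisk (z := fun k => if k ∈ t then y k else 0)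
    (Real.sqrt_nonneg _) (fun s => ?_) ?_
  · rw [Real.sq_sqrt (Finset.sum_nonneg fun k _ => by positivity)]
    calc ∑ k ∈ s, ‖(if k ∈ t then y k else 0 : Y k)‖ ^ 2
        = ∑ k ∈ s, if k ∈ t then ‖y k‖ ^ 2 else 0 :=
          Finset.sum_congr rfl fun k _ => by split_ifs <;> simp
      _ = ∑ k ∈ s ∩ t, ‖y k‖ ^ 2 := by rw [Finset.sum_ite_mem]
      _ ≤ ∑ k ∈ t, ‖y k‖ ^ 2 :=
          Finset.sum_le_sum_of_subset_of_nonneg Finset.inter_subset_right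
            fun k _ _ => by positivity
  · have h : HasSum (fun k => τ k (if k ∈ t then y k else 0))
        (∑ k ∈ t, τ k (if k ∈ t then y k else 0)) :=
      hasSum_sum_of_ne_finset_zero fun k hk => by simp [hk]
    have h' : ∑ k ∈ t, τ k (if k ∈ t then y k else 0) = ∑ k ∈ t, τ k (y k) :=
      Finset.sum_congr rfl fun k hk => by simp [hk]
    rw [h'] at h
    exact h.tendsto_sum_nat

theorem isDisk_seriesDisk [IsTopologicalAddGroup X] : IsDisk 𝕜 (seriesDisk τ) where
  zero_mem := ⟨0, (isDisk_squareSumBall (𝕜 := 𝕜)).zero_mem, by simp⟩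
  combo_mem := by
    rintro x ⟨z, hz, hzx⟩ y ⟨w, hw, hwy⟩ a b hab
    refine ⟨_, isDisk_squareSumBall.combo_mem z hz w hw a b hab, ?_⟩
    simpa [Finset.smul_sum, Finset.sum_add_distrib] using
      (hzx.const_smul a).add (hwy.const_smul b)

end Topological

variable [UniformSpace X] [IsUniformAddGroup X] [T2Space X] [CompleteSpace X]
  {p : SeminormFamily 𝕜 X ℕ} {τ : ∀ k, Y k →ₗ[𝕜] X}

/-- Coordinates in the ball have norm at most `1`, so in each seminorm the tails of the series are
bounded by those of `c`. Summation is thus continuous on the compact ball, and the disk is its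
image. -/
theorem SummablyBounded.isCompact_seriesDisk [∀ k, ProperSpace (Y k)] (hτ : SummablyBounded p τ)
    (hp : WithSeminorms p) : IsCompact (seriesDisk τ) := by
  have hU : UniformCauchySeqOn (fun N (z : ∀ k, Y k) => ∑ k ∈ Finset.range N, τ k (z k))
      atTop (squareSumBall Y 1) := by
    refine hp.uniformCauchySeqOn_sum (fun k (z : ∀ k, Y k) => τ k (z k)) fun n => ?_
    obtain ⟨c, hc0, hc, h⟩ := hτ n
    refine ⟨fun M => ∑' k, c (k + M), tendsto_sum_nat_add c, fun M N _ z hz => ?_⟩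
    refine le_trans ?_ (hc.sum_Ico_le_tsum_add hc0 M N)
    refine ((p n).sum_le _ _).trans (Finset.sum_le_sum fun k _ => (h k _).trans ?_)
    exact mul_le_of_le_one_right (hc0 k) (norm_le_of_mem_squareSumBall zero_le_one hz k)
  have hlim : ∀ z : ∀ k, Y k, ∃ x, z ∈ squareSumBall Y 1 →
      Tendsto (fun N => ∑ k ∈ Finset.range N, τ k (z k)) atTop (𝓝 x) := by
    intro z
    by_cases hz : z ∈ squareSumBall Y 1
    · obtain ⟨x, hx⟩ := cauchySeq_tendsto_of_complete (hU.cauchySeq hz)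
      exact ⟨x, fun _ => hx⟩
    · exact ⟨0, fun h => absurd h hz⟩
  choose T hT using hlim
  have himage : seriesDisk τ = T '' squareSumBall Y 1 := by
    ext x
    constructor
    · rintro ⟨z, hz, hx⟩
      exact ⟨z, hz, tendsto_nhds_unique (hT z hz) hx⟩
    · rintro ⟨z, hz, rfl⟩
      exact ⟨z, hz, hT z hz⟩
  rw [himage]
  refine (isCompact_squareSumBall zero_le_one).image_of_continuousOn ?_
  refine (hU.tendstoUniformlyOn_of_tendsto hT).continuousOn
    (Frequently.of_forall fun N => Continuous.continuousOn ?_)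
  exact continuous_finsetSum _ fun k _ => (hτ.continuous hp k).comp (continuous_apply k)

/-- The square-summable series of finite-dimensional blocks form a separable reflexive Banach space
whose unit ball is compact in `X`. -/
theorem SummablyBounded.exists_reflexive_normedSubspace [∀ k, ProperSpace (Y k)]
    (hτ : SummablyBounded p τ) (hp : WithSeminorms p) :
    ∃ E : NormedSubspace 𝕜 X, (CompleteSpace E.Space ∧ TopologicalSpace.SeparableSpace E.Space ∧
        IsReflexiveSpace 𝕜 E.Space ∧ IsCompact (E.incl '' Metric.closedBall 0 1)) ∧
      ∀ c : ℕ → ℝ, Summable c → ∃ Q : Set E.Space, IsCompact Q ∧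
        ∀ z : ∀ k, Y k, (∀ k, ‖z k‖ ≤ c k) → ∀ x,
          Tendsto (fun N => ∑ k ∈ Finset.range N, τ k (z k)) atTop (𝓝 x) → x ∈ E.incl '' Q := by
  have := hp.continuousSMul
  have hB : IsDisk 𝕜 (seriesDisk τ) := isDisk_seriesDisk
  have hK : IsCompact (seriesDisk τ) := hτ.isCompact_seriesDisk hp
  set E := hB.normedSubspace hK
  have hballK : E.incl '' Metric.closedBall 0 1 = seriesDisk τ := hB.image_closedBall hK
  have hcomplete : CompleteSpace E.Space := hB.completeSpace hp hK
  have hcont : Continuous E.incl := E.continuous_incl hp (hballK ▸ hK)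
  have hmem : ∀ k y, τ k y ∈ E.carrier := fun k y => by
    classical
    have := sum_mem_dilationSet_seriesDisk (τ := τ) {k} (Pi.single k y)
    simp only [Finset.sum_singleton, Pi.single_eq_same] at this
    exact ⟨_, this⟩
  let σ' : ∀ k, Y k →ₗ[𝕜] E.Space := fun k => (τ k).codRestrict E.carrier (hmem k)
  have hσ'norm : ∀ (t : Finset ℕ) (y : ∀ k, Y k),
      ‖∑ k ∈ t, σ' k (y k)‖ ^ 2 ≤ ∑ k ∈ t, ‖y k‖ ^ 2 := by
    intro t y
    refine (Real.le_sqrt (norm_nonneg _) (Finset.sum_nonneg fun k _ => by positivity)).1 ?_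
    refine (hB.norm_le_iff hK _ _).2 ?_
    have h : E.incl (∑ k ∈ t, σ' k (y k)) = ∑ k ∈ t, τ k (y k) := by
      rw [map_sum]; rfl
    change _ ∈ dilationSet 𝕜 _ (E.incl _)
    rw [h]
    exact sum_mem_dilationSet_seriesDisk t y
  let σ : ∀ k, Y k →L[𝕜] E.Space := fun k => (σ' k).mkContinuous 1 fun y => by
    classical
    have := hσ'norm {k} (Pi.single k y)
    simp only [Finset.sum_singleton, Pi.single_eq_same] at this
    rw [one_mul]
    exact le_of_sq_le_sq this (norm_nonneg _)
  have hσ : IsBlockContraction σ := hσ'norm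
  have hlim : ∀ z : ∀ k, Y k, Summable (fun k => σ k (z k)) →
      Tendsto (fun N => ∑ k ∈ Finset.range N, τ k (z k)) atTop (𝓝 (E.incl (∑' k, σ k (z k)))) := by
    intro z hz
    have := (hcont.tendsto _).comp hz.hasSum.tendsto_sum_nat
    refine this.congr fun N => ?_
    rw [Function.comp_apply, map_sum]
    rfl
  have hball : (fun z : ∀ k, Y k => ∑' k, σ k (z k)) '' squareSumBall Y 1 =
      Metric.closedBall (0 : E.Space) 1 := by
    -- The two sets are compared inside `X`, where sums taken in `E` and in `X` agree by continuity
    -- of the inclusion.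
    apply E.incl_injective.image_injective
    rw [hballK, Set.image_image]
    ext x
    constructor
    · rintro ⟨z, hz, rfl⟩
      exact ⟨z, hz, hlim z (summable_block hσ hz)⟩
    · rintro ⟨z, hz, hx⟩
      exact ⟨z, hz, tendsto_nhds_unique (hlim z (summable_block hσ hz)) hx⟩
  refine ⟨E, ⟨hcomplete, separableSpace_of_block hσ hball.ge, isReflexiveSpace_of_block hσ hball,
    hballK ▸ hK⟩, fun c hc => ⟨_, isCompact_image_tsum_block hσ hc, fun z hz x hx => ?_⟩⟩
  refine ⟨_, ⟨z, hz, rfl⟩, tendsto_nhds_unique (hlim z ?_) hx⟩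
  exact Summable.of_norm_bounded hc fun k => (norm_block_le hσ k (z k)).trans (hz k)

end Series

/-! ### Totally bounded sets as compact sets of a reflexive space -/

section Combination

variable {𝕜 : Type*} [RCLike 𝕜] {X : Type*} [AddCommGroup X] [Module 𝕜 X]

variable (𝕜) in
/-- The linear combinations of a finite set of vectors, rescaled by `2 ^ k`. -/
noncomputable def scaledCombination (k : ℕ) (F : Finset X) :
    PiLp 1 (fun _ : F => 𝕜) →ₗ[𝕜] X where
  toFun y := ∑ f : F, y f • (2 : 𝕜) ^ k • (f : X)
  map_add' y z := by simp [add_smul, Finset.sum_add_distrib]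
  map_smul' c y := by simp [mul_smul, Finset.smul_sum]

theorem seminorm_scaledCombination_le (q : Seminorm 𝕜 X) (k : ℕ) (F : Finset X) {C : ℝ}
    (hC : ∀ f ∈ F, 2 ^ k * q f ≤ C) (y : PiLp 1 (fun _ : F => 𝕜)) :
    q (scaledCombination 𝕜 k F y) ≤ C * ‖y‖ := by
  refine (q.sum_le _ _).trans ?_
  rw [PiLp.norm_eq_of_L1, Finset.mul_sum]
  refine Finset.sum_le_sum fun f _ => ?_
  rw [map_smul_eq_mul, map_smul_eq_mul, norm_pow, RCLike.norm_ofNat, mul_comm]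
  exact mul_le_mul_of_nonneg_right (hC f f.2) (norm_nonneg _)

/-- For `k > n` the smallness of `F k` gives `2 ^ k * 2 * 4 ^ (-(k - 1)) = 8 * 2 ^ (-k)`; the
finitely many `k ≤ n` get a crude bound, irrelevant for summability. -/
theorem summablyBounded_scaledCombination {p : SeminormFamily 𝕜 X ℕ} {F : ℕ → Finset X}
    (hF : ∀ k, ∀ f ∈ F (k + 1), ∀ n ≤ k, p n f ≤ 2 * (1 / 4) ^ k) :
    SummablyBounded p fun k => scaledCombination 𝕜 k (F k) := by
  intro n
  refine ⟨fun k => if n < k then 8 * (1 / 2) ^ k else ∑ f ∈ F k, 2 ^ k * p n f, fun k => ?_, ?_,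
    fun k y => seminorm_scaledCombination_le _ _ _ (fun f hf => ?_) _⟩
  · dsimp only
    split_ifs
    · positivity
    · exact Finset.sum_nonneg fun f _ => by positivity
  · rw [← summable_nat_add_iff (n + 1)]
    have : ∀ k, n < k + (n + 1) := fun k => by omega
    simp only [this, if_true]
    exact (summable_nat_add_iff (f := fun k => 8 * (1 / 2 : ℝ) ^ k) (n + 1)).2
      ((summable_geometric_of_lt_one (by norm_num) (by norm_num)).mul_left 8)
  · dsimp only
    split_ifs with h
    · obtain ⟨j, rfl⟩ : ∃ j, k = j + 1 := ⟨k - 1, by omega⟩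
      calc (2 : ℝ) ^ (j + 1) * p n f ≤ 2 ^ (j + 1) * (2 * (1 / 4) ^ j) := by
            gcongr
            exact hF j f hf n (by omega)
        _ = 8 * (1 / 2) ^ (j + 1) := by
            rw [show (1 / 4 : ℝ) = (1 / 2) * (1 / 2) by norm_num, mul_pow, pow_succ, pow_succ]
            have : (2 : ℝ) ^ j * (1 / 2) ^ j = 1 := by rw [← mul_pow]; norm_num
            linear_combination 4 * (1 / 2) ^ j * this
    · exact Finset.single_le_sum (f := fun f => (2 : ℝ) ^ k * p n f)
        (fun f _ => by positivity) hf

end Combination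

section TotallyBounded

variable {𝕜 : Type*} [RCLike 𝕜] {X : Type*} [AddCommGroup X] [Module 𝕜 X] [UniformSpace X]
  [IsUniformAddGroup X] {p : SeminormFamily 𝕜 X ℕ}

theorem WithSeminorms.exists_finset_net (hp : WithSeminorms p) {K : Set X} (hK : TotallyBounded K)
    (k : ℕ) {ε : ℝ} (hε : 0 < ε) :
    ∃ G : Finset X, ∀ x ∈ K, ∃ g ∈ G, ∀ n ≤ k, p n (x - g) < ε := by
  have hU : {x : X | ∀ n ≤ k, p n x < ε} ∈ 𝓝 (0 : X) := by
    refine (Filter.eventually_all_finite (Set.finite_le_nat k)).2 fun n _ => ?_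
    exact ((hp.continuous_seminorm n).tendsto' 0 0 (map_zero _)).eventually_lt_const hε
  obtain ⟨t, ht, hsub⟩ := totallyBounded_iff_subset_finite_iUnion_nhds_zero.1 hK _ hU
  refine ⟨ht.toFinset, fun x hx => ?_⟩
  obtain ⟨g, hg, y, hy, rfl⟩ := Set.mem_iUnion₂.1 (hsub hx)
  exact ⟨g, ht.mem_toFinset.2 hg, by simpa using hy⟩

/-- The points of a totally bounded set are sums of series whose `k`-th term is taken from a finite
set of small elements. -/
theorem WithSeminorms.exists_finset_series (hp : WithSeminorms p) {K : Set X}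
    (hK : TotallyBounded K) :
    ∃ F : ℕ → Finset X, (∀ k, ∀ f ∈ F (k + 1), ∀ n ≤ k, p n f ≤ 2 * (1 / 4) ^ k) ∧
      ∀ x ∈ K, ∃ f : ℕ → X, (∀ k, f k ∈ F k) ∧
        Tendsto (fun N => ∑ k ∈ Finset.range N, f k) atTop (𝓝 x) := by
  classical
  -- Precision `4 ^ (-k)` leaves the terms summable after the later rescaling by `2 ^ k`.
  choose G hG using fun k : ℕ =>
    hp.exists_finset_net hK k (ε := (1 / 4) ^ k) (by positivity)
  -- Differences of consecutive net points, filtered so that smallness holds by construction;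
  -- differences of two approximations of the same point pass the filter.
  let F : ℕ → Finset X := fun k => Nat.casesOn k (G 0) fun j =>
    ((G (j + 1) ×ˢ G j).image fun q => q.1 - q.2).filter fun f => ∀ n ≤ j, p n f ≤ 2 * (1 / 4) ^ j
  refine ⟨F, fun k f hf => (Finset.mem_filter.1 hf).2, fun x hx => ?_⟩
  choose g hgG hg using fun k => hG k x hx
  refine ⟨fun k => Nat.casesOn k (g 0) fun j => g (j + 1) - g j, fun k => ?_, ?_⟩
  · cases k with
    | zero => exact hgG 0
    | succ j =>
      refine Finset.mem_filter.2 ⟨Finset.mem_image.2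
        ⟨(g (j + 1), g j), Finset.mem_product.2 ⟨hgG _, hgG _⟩, rfl⟩, fun n hn => ?_⟩
      have h1 := hg j n hn
      have h2 := hg (j + 1) n (hn.trans j.le_succ)
      have h3 : ((1 : ℝ) / 4) ^ (j + 1) ≤ (1 / 4) ^ j :=
        pow_le_pow_of_le_one (by norm_num) (by norm_num) j.le_succ
      have h4 : p n (g (j + 1) - g j) ≤ p n (x - g j) + p n (x - g (j + 1)) := by
        have h5 : g (j + 1) - g j = (x - g j) - (x - g (j + 1)) := by abel
        rw [h5]
        exact map_sub_le_add _ _ _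
      change p n (g (j + 1) - g j) ≤ _
      linarith
  · rw [← tendsto_add_atTop_iff_nat 1]
    have hsum : ∀ N, ∑ k ∈ Finset.range (N + 1),
        (Nat.casesOn k (g 0) fun j => g (j + 1) - g j : X) = g N := by
      intro N
      rw [Finset.sum_range_succ']
      change ∑ k ∈ Finset.range N, (g (k + 1) - g k) + g 0 = g N
      rw [Finset.sum_range_sub, sub_add_cancel]
    simp_rw [hsum]
    refine (hp.tendsto_nhds_atTop g x).2 fun n ε hε => ?_
    obtain ⟨m, hm⟩ := exists_pow_lt_of_lt_one hε (by norm_num : (1 : ℝ) / 4 < 1)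
    refine ⟨max n m, fun k hk => ?_⟩
    rw [map_sub_rev]
    refine (hg k n ((le_max_left _ _).trans hk)).trans (lt_of_le_of_lt ?_ hm)
    exact pow_le_pow_of_le_one (by norm_num) (by norm_num) ((le_max_right _ _).trans hk)

/-- Every totally bounded set of a Fréchet space is contained in a compact subset of a separable
reflexive Banach space that is compactly embedded. -/
theorem WithSeminorms.exists_reflexive_normedSubspace [T2Space X] [CompleteSpace X]
    (hp : WithSeminorms p) {K : Set X} (hK : TotallyBounded K) :
    ∃ E : NormedSubspace 𝕜 X, (CompleteSpace E.Space ∧ TopologicalSpace.SeparableSpace E.Space ∧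
        IsReflexiveSpace 𝕜 E.Space ∧ IsCompact (E.incl '' Metric.closedBall 0 1)) ∧
      ∃ Q : Set E.Space, IsCompact Q ∧ K ⊆ E.incl '' Q := by
  classical
  obtain ⟨F, hF, hser⟩ := hp.exists_finset_series hK
  have : ∀ k, ProperSpace (PiLp 1 fun _ : F k => 𝕜) := fun k => FiniteDimensional.proper_rclike 𝕜 _
  obtain ⟨E, hE, hQ⟩ := (summablyBounded_scaledCombination hF).exists_reflexive_normedSubspace hp
  obtain ⟨Q, hQc, hQ⟩ := hQ (fun k => (1 / 2) ^ k)
    (summable_geometric_of_lt_one (by norm_num) (by norm_num))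
  refine ⟨E, hE, Q, hQc, fun x hx => ?_⟩
  obtain ⟨f, hfF, hfx⟩ := hser x hx
  -- The coordinate `2 ^ (-k)` cancels the factor `2 ^ k` in `scaledCombination` and has summable
  -- norm.
  refine hQ (fun k => PiLp.single 1 (⟨f k, hfF k⟩ : F k) ((1 / 2 : 𝕜) ^ k)) (fun k => ?_) x ?_
  · rw [PiLp.norm_single]
    simp
  · convert hfx using 4 with N k
    change ∑ g : F k, _ = _
    rw [Finset.sum_eq_single ⟨f k, hfF k⟩]
    · rw [PiLp.single_apply, if_pos rfl, smul_smul, ← mul_pow]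
      simp
    · intro g _ hg
      simp [hg]
    · simp

end TotallyBounded

/-! ### Restrictions of signed measures -/

section Restrict

variable {X Y : Type*} [MeasurableSpace X] [MeasurableSpace Y] {f : Y → X}

theorem MeasurableEmbedding.isFiniteMeasure_comap (hf : MeasurableEmbedding f) (μ : Measure X)
    [IsFiniteMeasure μ] : IsFiniteMeasure (μ.comap f) :=
  ⟨by rw [hf.comap_apply]; exact measure_lt_top _ _⟩

theorem MeasurableEmbedding.mutuallySingular_comap (hf : MeasurableEmbedding f) {μ ν : Measure X}
    (h : μ.MutuallySingular ν) : (μ.comap f).MutuallySingular (ν.comap f) := by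
  obtain ⟨s, hs, hμ, hν⟩ := h
  refine ⟨f ⁻¹' s, hf.measurable hs, ?_, ?_⟩
  · rw [hf.comap_apply]
    exact measure_mono_null (Set.image_preimage_subset f s) hμ
  · rw [hf.comap_apply, ← Set.preimage_compl]
    exact measure_mono_null (Set.image_preimage_subset f sᶜ) hν

/-- The pulled back positive and negative parts remain mutually singular, so by uniqueness they form
the Jordan decomposition of the restriction. -/
theorem totalVariation_restrictAlong (hf : MeasurableEmbedding f) (μ : SignedMeasure X) :
    (restrictAlong hf μ).totalVariation = μ.totalVariation.comap f := by
  have := hf.isFiniteMeasure_comap μ.toJordanDecomposition.posPart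
  have := hf.isFiniteMeasure_comap μ.toJordanDecomposition.negPart
  let j : JordanDecomposition Y :=
    { posPart := μ.toJordanDecomposition.posPart.comap f
      negPart := μ.toJordanDecomposition.negPart.comap f
      mutuallySingular := hf.mutuallySingular_comap μ.toJordanDecomposition.mutuallySingular }
  have hj : restrictAlong hf μ = j.toSignedMeasure := by
    ext i hi
    rw [JordanDecomposition.toSignedMeasure, Measure.toSignedMeasure_sub_apply hi]
    change μ (f '' i) = _
    rw [μ.apply_eq_posPart_real_sub_negPart_real (hf.measurableSet_image.2 hi)]
    simp only [Measure.real, j, hf.comap_apply]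
  rw [SignedMeasure.totalVariation, SignedMeasure.toJordanDecomposition_eq hj,
    SignedMeasure.totalVariation, hf.comap_add]

theorem MeasurableEmbedding.setLIntegral_comap_le (hf : MeasurableEmbedding f) (μ : Measure X)
    (s : Set X) (g : X → ENNReal) :
    ∫⁻ y in f ⁻¹' s, g (f y) ∂(μ.comap f) ≤ ∫⁻ x in s, g x ∂μ := by
  rw [← hf.lintegral_map, ← hf.restrict_map, hf.map_comap]
  exact lintegral_mono' (Measure.restrict_mono le_rfl Measure.restrict_le_self) le_rfl

end Restrict

/-- Signed measures on a Polish space are Radon. -/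
theorem isRadonSigned_of_polish {Y : Type*} [MeasurableSpace Y] [TopologicalSpace Y]
    [PolishSpace Y] [BorelSpace Y] (μ : SignedMeasure Y) : IsRadonSigned μ := by
  intro B hB ε hε
  obtain ⟨K, hKB, hK, h⟩ := hB.exists_isCompact_sdiff_lt (measure_ne_top μ.totalVariation B) hε.ne'
  exact ⟨K, hK, hKB, h⟩

/-! ### Integrals outside compact sets -/

/-- The integrals of `w` outside suitable compact sets are uniformly small. -/
def SmallOutsideCompacts {X : Type*} [MeasurableSpace X] [TopologicalSpace X]
    (M : Set (SignedMeasure X)) (w : X → ENNReal) : Prop :=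
  ∀ ε : ENNReal, 0 < ε →
    ∃ K : Set X, IsCompact K ∧ ∀ μ ∈ M, ∫⁻ x in Kᶜ, w x ∂μ.totalVariation ≤ ε

section SmallOutside

variable {X : Type*} [MeasurableSpace X] [TopologicalSpace X] {M : Set (SignedMeasure X)}

theorem UniformlyTight.smallOutsideCompacts_one (hM : UniformlyTight M) :
    SmallOutsideCompacts M fun _ => 1 := fun ε hε => by
  obtain ⟨K, hK, h⟩ := hM ε hε
  exact ⟨K, hK, fun μ hμ => by simpa using (h μ hμ).le⟩

theorem SmallOutsideCompacts.add {v w : X → ENNReal} (hv : SmallOutsideCompacts M v)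
    (hw : SmallOutsideCompacts M w) (hvm : Measurable v) :
    SmallOutsideCompacts M fun x => v x + w x := fun ε hε => by
  obtain ⟨K, hK, h⟩ := hv (ε / 2) (ENNReal.half_pos hε.ne')
  obtain ⟨L, hL, h'⟩ := hw (ε / 2) (ENNReal.half_pos hε.ne')
  refine ⟨K ∪ L, hK.union hL, fun μ hμ => ?_⟩
  rw [lintegral_add_left hvm, ← ENNReal.add_halves ε]
  refine add_le_add ((lintegral_mono_set ?_).trans (h μ hμ)) ((lintegral_mono_set ?_).trans (h' μ hμ))
  · exact Set.compl_subset_compl.2 Set.subset_union_left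
  · exact Set.compl_subset_compl.2 Set.subset_union_right

theorem SmallOutsideCompacts.one_add_sum (hM : UniformlyTight M) {w : ℕ → X → ENNReal}
    (hw : ∀ n, SmallOutsideCompacts M (w n)) (hwm : ∀ n, Measurable (w n)) (j : ℕ) :
    SmallOutsideCompacts M fun x => 1 + ∑ n ∈ Finset.range j, w n x := by
  induction j with
  | zero => simpa using hM.smallOutsideCompacts_one
  | succ j ih =>
    simp_rw [Finset.sum_range_succ, ← add_assoc]
    exact ih.add (hw j)
      (measurable_const.add (Finset.measurable_sum _ fun n _ => hwm n))

/-- Uniform integrability and uniform tightness make the integrals outside compact sets small. -/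
theorem UniformlyTight.smallOutsideCompacts (hM : UniformlyTight M) {q : X → ℝ} (hq : Measurable q)
    (hint : UniformlyIntegrableOver M q) :
    SmallOutsideCompacts M fun x => ENNReal.ofReal (q x) := by
  intro ε hε
  have hε2 : 0 < ε / 2 := ENNReal.half_pos hε.ne'
  obtain ⟨m, hm⟩ := (ENNReal.tendsto_nhds_zero.1 hint (ε / 2) hε2).exists
  -- Outside `K`, the part `{q > m}` is controlled by uniform integrability and the part `{q ≤ m}`
  -- by `m * |μ|(Kᶜ)`. The `+ 1` keeps the divisor nonzero.
  obtain ⟨K, hK, h⟩ := hM (ε / 2 / (ENNReal.ofReal m + 1))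
    (ENNReal.div_pos hε2.ne' (by simp))
  refine ⟨K, hK, fun μ hμ => ?_⟩
  have hs : MeasurableSet {x | m < q x} := measurableSet_lt measurable_const hq
  have hm' : ∫⁻ x in {x | m < q x}, ENNReal.ofReal (q x) ∂μ.totalVariation ≤ ε / 2 :=
    (le_iSup₂ (f := fun (μ : SignedMeasure X) (_ : μ ∈ M) =>
      ∫⁻ x in {x | m < q x}, ENNReal.ofReal (q x) ∂μ.totalVariation) μ hμ).trans hm
  rw [← lintegral_inter_add_sdiff _ _ hs, ← ENNReal.add_halves ε]
  refine add_le_add ((lintegral_mono_set Set.inter_subset_right).trans hm') ?_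
  calc ∫⁻ x in Kᶜ \ {x | m < q x}, ENNReal.ofReal (q x) ∂μ.totalVariation
      ≤ ∫⁻ _ in Kᶜ \ {x | m < q x}, ENNReal.ofReal m ∂μ.totalVariation := by
        refine setLIntegral_mono measurable_const fun x hx => ENNReal.ofReal_le_ofReal ?_
        exact not_lt.1 hx.2
    _ ≤ (ENNReal.ofReal m + 1) * μ.totalVariation Kᶜ := by
        rw [setLIntegral_const]
        gcongr
        · exact le_self_add
        · exact Set.sdiff_subset
    _ ≤ (ENNReal.ofReal m + 1) * (ε / 2 / (ENNReal.ofReal m + 1)) := by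
        gcongr
        exact (h μ hμ).le
    _ ≤ ε / 2 := ENNReal.mul_div_le

theorem exists_monotone_compacts_setLIntegral_le {w : ℕ → X → ENNReal}
    (hw : ∀ j, SmallOutsideCompacts M (w j)) {ε : ℕ → ENNReal} (hε : ∀ j, 0 < ε j) :
    ∃ K : ℕ → Set X, Monotone K ∧ (∀ j, IsCompact (K j)) ∧
      ∀ j, ∀ μ ∈ M, ∫⁻ x in (K j)ᶜ, w j x ∂μ.totalVariation ≤ ε j := by
  choose K hK h using fun j => hw j (ε j) (hε j)
  refine ⟨Set.accumulate K, Set.monotone_accumulate, fun j => ?_, fun j μ hμ => ?_⟩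
  · exact (Set.finite_le_nat j).isCompact_biUnion fun i _ => hK i
  · exact (lintegral_mono_set (Set.compl_subset_compl.2 Set.subset_accumulate)).trans (h j μ hμ)

end SmallOutside

/-! ### Compact sets absorbing a sequence of compact sets -/

/-- The single translate `0 + U` covers all but finitely many `A j`; the remaining ones have finite
nets. -/
theorem TotallyBounded.iUnion_of_eventually_subset {X : Type*} [AddCommGroup X] [UniformSpace X]
    [IsUniformAddGroup X] {A : ℕ → Set X} (hA : ∀ j, TotallyBounded (A j))
    (h : ∀ U ∈ 𝓝 (0 : X), ∀ᶠ j in atTop, A j ⊆ U) : TotallyBounded (⋃ j, A j) := by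
  rw [totallyBounded_iff_subset_finite_iUnion_nhds_zero]
  intro U hU
  obtain ⟨N, hN⟩ := eventually_atTop.1 (h U hU)
  choose t ht hsub using fun j => totallyBounded_iff_subset_finite_iUnion_nhds_zero.1 (hA j) U hU
  refine ⟨insert 0 (⋃ j ∈ Set.Iio N, t j),
    ((Set.finite_lt_nat N).biUnion fun j _ => ht j).insert 0, Set.iUnion_subset fun j x hx => ?_⟩
  rw [Set.mem_iUnion₂]
  rcases le_or_gt N j with hj | hj
  · exact ⟨0, Set.mem_insert _ _, x, hN j hj hx, zero_add x⟩
  · obtain ⟨y, hy, hxy⟩ := Set.mem_iUnion₂.1 (hsub j hx)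
    exact ⟨y, Set.mem_insert_of_mem _ (Set.mem_biUnion hj hy), hxy⟩

section Weight

variable {𝕜 : Type*} [RCLike 𝕜] {X : Type*} [AddCommGroup X] [Module 𝕜 X]

/-- The function `1 + p 0 + ⋯ + p j`. -/
def seminormWeight (p : SeminormFamily 𝕜 X ℕ) (j : ℕ) (x : X) : ℝ :=
  1 + ∑ n ∈ Finset.range (j + 1), p n x

variable {p : SeminormFamily 𝕜 X ℕ}

theorem one_le_seminormWeight (j : ℕ) (x : X) : 1 ≤ seminormWeight p j x :=
  le_add_of_nonneg_right (Finset.sum_nonneg fun _ _ => apply_nonneg _ _)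

theorem seminormWeight_pos (j : ℕ) (x : X) : 0 < seminormWeight p j x :=
  one_pos.trans_le (one_le_seminormWeight j x)

theorem le_seminormWeight {n j : ℕ} (hn : n ≤ j) (x : X) : p n x ≤ seminormWeight p j x := by
  have := Finset.single_le_sum (f := fun n => p n x) (fun n _ => apply_nonneg (p n) x)
    (Finset.mem_range.2 (Nat.lt_succ_of_le hn))
  exact this.trans (le_add_of_nonneg_left zero_le_one)

theorem ofReal_seminormWeight (j : ℕ) (x : X) : ENNReal.ofReal (seminormWeight p j x) =
    1 + ∑ n ∈ Finset.range (j + 1), ENNReal.ofReal (p n x) := by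
  rw [seminormWeight, ENNReal.ofReal_add zero_le_one
    (Finset.sum_nonneg fun _ _ => apply_nonneg _ _), ENNReal.ofReal_one,
    ENNReal.ofReal_sum_of_nonneg fun _ _ => apply_nonneg _ _]

theorem WithSeminorms.continuous_seminormWeight [TopologicalSpace X] (hp : WithSeminorms p)
    (j : ℕ) : Continuous (seminormWeight p j) :=
  continuous_const.add (continuous_finsetSum _ fun n _ => hp.continuous_seminorm n)

theorem SmallOutsideCompacts.seminormWeight [TopologicalSpace X] [MeasurableSpace X]
    [BorelSpace X] (hp : WithSeminorms p) {M : Set (SignedMeasure X)} (htight : UniformlyTight M)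
    (hint : ∀ n, UniformlyIntegrableOver M (p n)) (j : ℕ) :
    SmallOutsideCompacts M fun x => ENNReal.ofReal (seminormWeight p j x) := by
  simp_rw [ofReal_seminormWeight]
  have hm : ∀ n, Measurable (p n) := fun n => (hp.continuous_seminorm n).measurable
  exact SmallOutsideCompacts.one_add_sum htight
    (fun n => htight.smallOutsideCompacts (hm n) (hint n)) (fun n => (hm n).ennreal_ofReal) (j + 1)

variable [UniformSpace X] [IsUniformAddGroup X] [T2Space X] [CompleteSpace X]

/-- A sequence of compact sets of a Fréchet space lies, after division by `2 ^ j` and the weights,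
in a compact set of a separable reflexive Banach space that is compactly embedded. -/
theorem WithSeminorms.exists_reflexive_normedSubspace_of_compacts (hp : WithSeminorms p)
    {K : ℕ → Set X} (hK : ∀ j, IsCompact (K j)) :
    ∃ E : NormedSubspace 𝕜 X, (CompleteSpace E.Space ∧ TopologicalSpace.SeparableSpace E.Space ∧
        IsReflexiveSpace 𝕜 E.Space ∧ IsCompact (E.incl '' Metric.closedBall 0 1)) ∧
      ∃ Q : Set E.Space, IsCompact Q ∧ ∀ j, ∀ x ∈ K j, ∃ e ∈ Q,
        E.incl (((2 ^ j * seminormWeight p j x : ℝ) : 𝕜) • e) = x := by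
  have := hp.continuousSMul
  have hpos : ∀ j x, 0 < 2 ^ j * seminormWeight p j x := fun j x =>
    mul_pos (by positivity) (seminormWeight_pos j x)
  set A : ℕ → Set X := fun j =>
    (fun x => (((2 ^ j * seminormWeight p j x)⁻¹ : ℝ) : 𝕜) • x) '' K j with hA
  have hAc : ∀ j, IsCompact (A j) := fun j => by
    refine (hK j).image (Continuous.smul (RCLike.continuous_ofReal.comp ?_) continuous_id)
    exact (continuous_const.mul (hp.continuous_seminormWeight j)).inv₀ fun x => (hpos j x).ne'
  -- The weight absorbs `p n x`, and the factor `2 ^ j` drives the sets to `0`.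
  have hAp : ∀ n j, n ≤ j → ∀ a ∈ A j, p n a ≤ (1 / 2) ^ j := by
    rintro n j hn _ ⟨x, -, rfl⟩
    rw [map_smul_eq_mul, RCLike.norm_ofReal, abs_of_pos (inv_pos.2 (hpos j x)),
      inv_mul_le_iff₀ (hpos j x), mul_right_comm, ← mul_pow]
    simpa using le_seminormWeight hn x
  have htb : TotallyBounded (⋃ j, A j) := by
    refine TotallyBounded.iUnion_of_eventually_subset (fun j => (hAc j).totallyBounded)
      fun U hU => ?_
    obtain ⟨⟨s, r⟩, hr, hsub⟩ := hp.hasBasis_zero_ball.mem_iff.1 hU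
    have hlim : Tendsto (fun j : ℕ => ((1 : ℝ) / 2) ^ j) atTop (𝓝 0) :=
      tendsto_pow_atTop_nhds_zero_of_lt_one (by norm_num) (by norm_num)
    filter_upwards [hlim.eventually_lt_const hr, eventually_ge_atTop (s.sup id)] with j hj hjs a ha
    refine hsub ?_
    rw [Seminorm.mem_ball_zero]
    refine Seminorm.finset_sup_apply_lt hr fun n hn => (hAp n j ?_ a ha).trans_lt hj
    exact (Finset.le_sup (f := id) hn).trans hjs
  obtain ⟨E, hE, Q, hQ, hsub⟩ := hp.exists_reflexive_normedSubspace htb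
  refine ⟨E, hE, Q, hQ, fun j x hx => ?_⟩
  obtain ⟨e, he, hex⟩ := hsub (Set.mem_iUnion.2 ⟨j, x, hx, rfl⟩)
  refine ⟨e, he, ?_⟩
  rw [map_smul, hex, smul_smul, ← RCLike.ofReal_mul, mul_inv_cancel₀ (hpos j x).ne']
  simp

end Weight

/-! ### Integrals of the norm of an embedded Banach space -/

section Embedded

variable {𝕜 : Type*} [RCLike 𝕜] {X : Type*} [AddCommGroup X] [Module 𝕜 X]
  {E : NormedSubspace 𝕜 X} {K : ℕ → Set X} {w : ℕ → X → ℝ} {Q : Set E.Space}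

/-- The preimage is closed in `E` and lies in the image of the compact set `w(K) × Q` under scalar
multiplication, so compactness in `X` lifts to the finer topology of `E`. -/
theorem NormedSubspace.isCompact_preimage_incl [TopologicalSpace X] [T2Space X]
    (hE : Continuous E.incl) (hQ : IsCompact Q) {K : Set X} (hK : IsCompact K) {w : X → ℝ}
    (hw : ContinuousOn w K) (hKQ : ∀ x ∈ K, ∃ e ∈ Q, E.incl ((w x : 𝕜) • e) = x) :
    IsCompact (E.incl ⁻¹' K) := by
  have himg : IsCompact ((fun q : ℝ × E.Space => (q.1 : 𝕜) • q.2) '' ((w '' K) ×ˢ Q)) :=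
    ((hK.image_of_continuousOn hw).prod hQ).image
      (Continuous.smul (f := fun q : ℝ × E.Space => (q.1 : 𝕜))
        (RCLike.continuous_ofReal.comp continuous_fst) continuous_snd)
  refine himg.of_isClosed_subset (hK.isClosed.preimage hE) fun e he => ?_
  obtain ⟨q, hq, h⟩ := hKQ _ he
  exact ⟨(w (E.incl e), q), ⟨⟨_, he, rfl⟩, hq⟩, E.incl_injective h⟩

variable [MeasurableSpace X]

/-- If `‖x‖ ≤ R * 2 ^ j * w j x` on `K (j + 1)` and `∫ w j` outside `K j` is at most `4 ^ (-j)`,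
the integral of the norm outside `K N` is of order `2 ^ (-N)`. -/
theorem NormedSubspace.setLIntegral_norm_compl_le (hE : MeasurableEmbedding E.incl)
    (hK : Monotone K) (hKm : ∀ j, MeasurableSet (K j)) (hwm : ∀ j, Measurable (w j)) {R : ℝ}
    (hR : 0 ≤ R)
    (hnorm : ∀ j, ∀ e : E.Space, E.incl e ∈ K (j + 1) → ‖e‖ ≤ R * (2 ^ j * w j (E.incl e)))
    {ν : Measure X} (hν : ν (⋃ j, K j)ᶜ = 0)
    (hint : ∀ j, ∫⁻ x in (K j)ᶜ, ENNReal.ofReal (w j x) ∂ν ≤ (1 / 4) ^ j) (N : ℕ) :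
    ∫⁻ e in E.incl ⁻¹' (K N)ᶜ, ENNReal.ofReal ‖e‖ ∂(ν.comap E.incl) ≤
      ENNReal.ofReal R * ((1 / 2) ^ N * 2) := by
  set g : ℕ → X → ENNReal := fun j x => ENNReal.ofReal R * (2 ^ j * ENNReal.ofReal (w j x)) with hg
  have hgm : ∀ j, Measurable (g j) := fun j =>
    ((hwm j).ennreal_ofReal.const_mul _).const_mul _
  have hae : ∀ᵐ e ∂(ν.comap E.incl), E.incl e ∈ ⋃ j, K j := by
    rw [ae_iff, hE.comap_apply]
    refine measure_mono_null ?_ hν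
    rintro _ ⟨e, he, rfl⟩
    exact he
  -- Almost every point outside `K N` lies in a shell `K (N + i + 1) \ K (N + i)`, found from the
  -- first index whose set contains it; the `i`-th term alone dominates the norm there.
  have hpt : ∀ᵐ e ∂(ν.comap E.incl), e ∈ E.incl ⁻¹' (K N)ᶜ → ENNReal.ofReal ‖e‖ ≤
      ∑' i, (E.incl ⁻¹' (K (N + i))ᶜ).indicator (fun e => g (N + i) (E.incl e)) e := by
    filter_upwards [hae] with e he heN
    classical
    have hex : ∃ j, E.incl e ∈ K j := Set.mem_iUnion.1 he
    have hlt : N < Nat.find hex := by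
      by_contra hle
      exact heN (hK (not_lt.1 hle) (Nat.find_spec hex))
    obtain ⟨i, hi⟩ := Nat.exists_eq_add_of_lt hlt
    have hmem : E.incl e ∈ K (N + i + 1) := hi ▸ Nat.find_spec hex
    have hnot : E.incl e ∉ K (N + i) := Nat.find_min hex (by omega)
    refine le_trans ?_ (ENNReal.le_tsum i)
    rw [Set.indicator_of_mem (by exact hnot)]
    refine (ENNReal.ofReal_le_ofReal (hnorm _ e hmem)).trans_eq ?_
    rw [ENNReal.ofReal_mul hR, ENNReal.ofReal_mul (by positivity), ENNReal.ofReal_pow (by positivity)]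
    simp [hg]
  have hterm : ∀ i, ∫⁻ e, (E.incl ⁻¹' (K (N + i))ᶜ).indicator (fun e => g (N + i) (E.incl e)) e
      ∂(ν.comap E.incl) ≤ ENNReal.ofReal R * ((1 / 2) ^ N * (1 / 2) ^ i) := by
    intro i
    rw [lintegral_indicator (hE.measurable (hKm _).compl)]
    refine (hE.setLIntegral_comap_le ν _ (g (N + i))).trans ?_
    rw [hg, lintegral_const_mul _ ((hwm _).ennreal_ofReal.const_mul _),
      lintegral_const_mul _ (hwm _).ennreal_ofReal]
    refine mul_le_mul_right ?_ _
    calc 2 ^ (N + i) * ∫⁻ x in (K (N + i))ᶜ, ENNReal.ofReal (w (N + i) x) ∂ν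
        ≤ (2 : ENNReal) ^ (N + i) * (1 / 4) ^ (N + i) := by gcongr; exact hint _
      _ = (1 / 2) ^ N * (1 / 2) ^ i := by
        rw [← mul_pow, ← pow_add]
        congr 1
        rw [show (4 : ENNReal) = 2 * 2 by norm_num, one_div, one_div,
          ENNReal.mul_inv (by simp) (by simp), ← mul_assoc,
          ENNReal.mul_inv_cancel (by simp) (by simp), one_mul]
  calc ∫⁻ e in E.incl ⁻¹' (K N)ᶜ, ENNReal.ofReal ‖e‖ ∂(ν.comap E.incl)
      ≤ ∫⁻ e in E.incl ⁻¹' (K N)ᶜ, ∑' i, (E.incl ⁻¹' (K (N + i))ᶜ).indicator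
          (fun e => g (N + i) (E.incl e)) e ∂(ν.comap E.incl) :=
        setLIntegral_mono_ae' (hE.measurable (hKm N).compl) hpt
    _ ≤ ∫⁻ e, ∑' i, (E.incl ⁻¹' (K (N + i))ᶜ).indicator
          (fun e => g (N + i) (E.incl e)) e ∂(ν.comap E.incl) := setLIntegral_le_lintegral _ _
    _ = ∑' i, ∫⁻ e, (E.incl ⁻¹' (K (N + i))ᶜ).indicator
          (fun e => g (N + i) (E.incl e)) e ∂(ν.comap E.incl) :=
        lintegral_tsum fun i => (((hgm _).comp hE.measurable).indicator
          (hE.measurable (hKm _).compl)).aemeasurable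
    _ ≤ ∑' i, ENNReal.ofReal R * ((1 / 2) ^ N * (1 / 2) ^ i) := ENNReal.tsum_le_tsum hterm
    _ = ENNReal.ofReal R * ((1 / 2) ^ N * 2) := by
        rw [ENNReal.tsum_mul_left, ENNReal.tsum_mul_left, ENNReal.tsum_geometric, one_div,
          ENNReal.one_sub_inv_two, inv_inv]

end Embedded

/-! ### Assembly of the main theorem -/

theorem theorem2p6 {𝕜 : Type*} [RCLike 𝕜]
    -- a Fréchet space, with a sequence of seminorms generating its topology
    {X : Type*} [AddCommGroup X] [Module 𝕜 X] [UniformSpace X] [IsUniformAddGroup X]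
    [T2Space X] [CompleteSpace X] (p : SeminormFamily 𝕜 X ℕ) (hp : WithSeminorms p)
    [MeasurableSpace X] [BorelSpace X]
    (M : Set (SignedMeasure X)) (hradon : ∀ μ ∈ M, IsRadonSigned μ)
    (htight : UniformlyTight M) (hint : ∀ n, UniformlyIntegrableOver M (p n)) :
    ∃ E : NormedSubspace 𝕜 X,
      -- (i) `E` is a separable reflexive Banach space whose closed unit ball is compact in `X`
      (CompleteSpace E.Space ∧ TopologicalSpace.SeparableSpace E.Space ∧
        IsReflexiveSpace 𝕜 E.Space ∧ IsCompact (E.incl '' Metric.closedBall 0 1)) ∧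
      -- (ii) Borel sets of `E` are Borel in `X`, `M` is concentrated on `E`, its restriction to
      -- `E` is a uniformly tight family of Radon measures and the norm is uniformly integrable
      ∃ hE : MeasurableEmbedding E.incl,
        (∀ μ ∈ M, μ.totalVariation (E.carrier : Set X)ᶜ = 0) ∧
        (∀ μ ∈ M, IsRadonSigned (restrictAlong hE μ)) ∧
        UniformlyTight (restrictAlong hE '' M) ∧
        UniformlyIntegrableOver (restrictAlong hE '' M) (fun x : E.Space => ‖x‖) := by
  obtain ⟨K, hKmono, hKc, hKint⟩ := exists_monotone_compacts_setLIntegral_le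
    (fun j => SmallOutsideCompacts.seminormWeight hp htight hint j)
    (ε := fun j => (1 / 4) ^ j) (fun j => ENNReal.pow_pos (by simp) j)
  have hKm : ∀ j, MeasurableSet (K j) := fun j => (hKc j).measurableSet
  have hpow : ∀ a : ENNReal, a < 1 → Tendsto (fun j : ℕ => a ^ j) atTop (𝓝 0) :=
    fun a ha => ENNReal.tendsto_pow_atTop_nhds_zero_of_lt_one ha
  have hKcompl : ∀ j, ∀ μ ∈ M, μ.totalVariation (K j)ᶜ ≤ (1 / 4) ^ j := by
    intro j μ hμ
    refine le_trans ?_ (hKint j μ hμ)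
    rw [← setLIntegral_one]
    refine lintegral_mono fun x => ?_
    rw [← ENNReal.ofReal_one]
    exact ENNReal.ofReal_le_ofReal (one_le_seminormWeight j x)
  -- The shift pairs `K (j + 1)` with `w j`: on `K (j + 1) \ K j` the norm is bounded through `w j`,
  -- whose integral outside `K j` is at most `4 ^ (-j)`.
  obtain ⟨E, hEi, Q, hQ, hEQ⟩ :=
    hp.exists_reflexive_normedSubspace_of_compacts (fun j => hKc (j + 1))
  obtain ⟨hcomplete, hsep, -, hball⟩ := id hEi
  have hcont : Continuous E.incl := E.continuous_incl hp hball
  have : SecondCountableTopology E.Space := UniformSpace.secondCountable_of_separable _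
  -- Lusin–Souslin: `E` is complete and separable, hence Polish, so its Borel sets have Borel images
  -- under the injective continuous inclusion.
  have hE : MeasurableEmbedding E.incl := hcont.measurableEmbedding E.incl_injective
  have hnull : ∀ μ ∈ M, μ.totalVariation (⋃ j, K j)ᶜ = 0 := by
    intro μ hμ
    refine le_antisymm (ge_of_tendsto' (hpow (1 / 4) (by norm_num)) fun j => ?_) bot_le
    exact (measure_mono (Set.compl_subset_compl.2 (Set.subset_iUnion K j))).trans (hKcompl j μ hμ)
  have hKE : ∀ j, ∀ x ∈ K j, x ∈ E.carrier := by
    intro j x hx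
    obtain ⟨e, -, he⟩ := hEQ j x (hKmono j.le_succ hx)
    rw [← he]
    exact Subtype.prop (p := fun x => x ∈ E.carrier) _
  have hKcE : ∀ j, IsCompact (E.incl ⁻¹' K j) := by
    intro j
    refine NormedSubspace.isCompact_preimage_incl hcont hQ (hKc j)
      (w := fun x => 2 ^ j * seminormWeight p j x)
      (continuous_const.mul (hp.continuous_seminormWeight j)).continuousOn
      fun x hx => hEQ j x (hKmono j.le_succ hx)
  obtain ⟨R, hR0, hR⟩ := hQ.isBounded.exists_pos_norm_le
  have hnorm : ∀ j, ∀ e : E.Space, E.incl e ∈ K (j + 1) →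
      ‖e‖ ≤ R * (2 ^ j * seminormWeight p j (E.incl e)) := by
    intro j e he
    obtain ⟨q, hq, hqe⟩ := hEQ j _ he
    have hpos : 0 ≤ 2 ^ j * seminormWeight p j (E.incl e) :=
      mul_nonneg (by positivity) (seminormWeight_pos j _).le
    calc ‖e‖ = ‖((2 ^ j * seminormWeight p j (E.incl e) : ℝ) : 𝕜) • q‖ := by
          rw [E.incl_injective hqe]
      _ = 2 ^ j * seminormWeight p j (E.incl e) * ‖q‖ := by
          rw [norm_smul, RCLike.norm_ofReal, abs_of_nonneg hpos]
      _ ≤ 2 ^ j * seminormWeight p j (E.incl e) * R := by gcongr; exact hR q hq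
      _ = _ := mul_comm _ _
  refine ⟨E, hEi, hE, fun μ hμ => ?_, fun μ _ => isRadonSigned_of_polish _, fun ε hε => ?_, ?_⟩
  · refine measure_mono_null (Set.compl_subset_compl.2 ?_) (hnull μ hμ)
    exact Set.iUnion_subset hKE
  · obtain ⟨j, hj⟩ := ((hpow (1 / 4) (by norm_num)).eventually_lt_const hε).exists
    refine ⟨E.incl ⁻¹' K j, hKcE j, ?_⟩
    rintro _ ⟨μ, hμ, rfl⟩
    rw [totalVariation_restrictAlong, hE.comap_apply, ← Set.preimage_compl]
    exact (measure_mono (Set.image_preimage_subset _ _)).trans_lt ((hKcompl j μ hμ).trans_lt hj)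
  · have hlim : Tendsto (fun N : ℕ => ENNReal.ofReal R * ((1 / 2) ^ N * 2)) atTop (𝓝 0) := by
      have h2 := ENNReal.Tendsto.mul_const (b := 2) (hpow (1 / 2) (by norm_num)) (Or.inr (by simp))
      have h3 := ENNReal.Tendsto.const_mul (a := ENNReal.ofReal R) h2 (Or.inr (by simp))
      simpa using h3
    refine ENNReal.tendsto_nhds_zero.2 fun ε hε => ?_
    obtain ⟨N, hN⟩ := (hlim.eventually_le_const hε).exists
    -- The trace of `K N` on `E` is norm bounded, so for `m ≥ m₀` the set `{‖e‖ > m}` lies outside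
    -- it and the tail estimate applies uniformly in `μ`.
    obtain ⟨m₀, -, hm₀⟩ := (hKcE N).isBounded.exists_pos_norm_le
    filter_upwards [eventually_ge_atTop m₀] with m hm
    refine iSup₂_le ?_
    rintro _ ⟨μ, hμ, rfl⟩
    rw [totalVariation_restrictAlong]
    refine (lintegral_mono_set ?_).trans ((NormedSubspace.setLIntegral_norm_compl_le hE hKmono hKm
      (fun j => (hp.continuous_seminormWeight j).measurable) hR0.le hnorm (hnull μ hμ)
      (fun j => hKint j μ hμ) N).trans hN)
    intro e he heK
    exact absurd (hm₀ e heK) (not_le.2 (lt_of_le_of_lt hm he))
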